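/- Conventions. Let $K$ be a non-empty locally compact Hausdorff space, $M(K)$ the space of regular complex Borel measures on $K$, and $M^+(K)\subset M(K)$ the cone of finite non-negative ones with the cone topology, i.e. the weak topology induced by $C_c^+(K)\cup\{1\}$; $p_x$ is the point mass at $x$. $K$ is a semitopological semihypergroup if $M(K)$ carries a bilinear associative operation $*$ such that: (i) $\mu*\nu\in M^+(K)$ for $\mu,\nu\in M^+(K)$, and for each $\omega\in M^+(K)$ the maps $\mu\mapsto\omega*\mu$ and $\mu\mapsto\mu*\omega$ on $M^+(K)$ are continuous; (ii) for all $x,y\in K$, $p_x*p_y$ is a probability measure with compact support; (iii) $(x,y)\mapsto\operatorname{supp}(p_x*p_y)$ is continuous from $K\times K$ to the space of compact subsets of $K$ with the Michael (Vietoris) topology. For a bounded continuous $f:K\to\mathbb C$ put $L_xf(y)=\int_K f\,d(p_x*p_y)$. $AP(K)$ is the space of all bounded continuous $f$ such that $\{L_xf:x\in K\}$ is relatively compact in the supremum norm. $AP(K)$ is left amenable if there is $m\in AP(K)^*$ with $\|m\|=m(1)=1$ and $m(L_xf)=m(f)$ for all $x\in K$, $f\in AP(K)$. Let $(E,Q)$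 be a separated locally convex space, $Q$ being a family of seminorms that induces its topology, and let $C\subseteq E$ be non-empty, compact and convex. An action of $K$ on $C$ is a map $\pi:K\times C\to C$ such that $\pi(s,\pi(t,x))=\int_K\pi(\zeta,x)\,d(p_s*p_t)(\zeta)$ for all $s,t\in K$, $x\in C$ (a weak vector-valued integral), and such that $\pi(e,x)=x$ for all $x \in C$ whenever $e$ is a two-sided identity of $K$ (i.e. $p_x*p_e=p_e*p_x=p_x$ for all $x\in K$). It is separately continuous if $\pi$ is continuous in each variable, and non-expansive if $p(\pi(s,x)-\pi(s,y))\le p(x-y)$ for all $p\in Q$, $s\in K$, $x,y\in C$. A common fixed point is an $x\in C$ with $\pi(s,x)=x$ for all $s\in K$. Theorem. Let $K$ be a semitopological semihypergroup. Then $AP(K)$ is left amenable if and only if, for every separated locally convex space $(E,Q)$ and every non-empty compact convex $C\subseteq E$, every separately continuous, non-expansive action of $K$ on $C$ has a common fixed point. -/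

import Mathlib

open MeasureTheory Topology BoundedContinuousFunction CompactlySupported
open scoped NNReal ENNReal

universe u v

noncomputable section

namespace Semihyper

variable {K : Type*} [TopologicalSpace K] [MeasurableSpace K] [BorelSpace K]

/-! ### Regular complex Borel measures -/

/-- A measure dominated by a finite regular measure is regular. -/
theorem regular_of_le [T2Space K] {μ ν : Measure K} [IsFiniteMeasure μ] [μ.Regular]
    (h : ν ≤ μ) : ν.Regular := by
  have : IsFiniteMeasure ν := isFiniteMeasure_of_le μ h
  have : ν.InnerRegularCompactLTTop := by
    refine ⟨fun A hA r hr => ?_⟩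
    obtain ⟨hAm, -⟩ := hA
    have hpos : ν A - r ≠ 0 := (tsub_pos_of_lt hr).ne'
    obtain ⟨C, hCA, hC, hlt⟩ := hAm.exists_isCompact_sdiff_lt (μ := μ) (measure_ne_top μ A) hpos
    refine ⟨C, hCA, hC, ?_⟩
    have h1 : ν A ≤ ν C + ν (A \ C) := by
      rw [measure_add_sdiff hC.measurableSet.nullMeasurableSet]
      exact measure_mono Set.subset_union_right
    have h2 : ν (A \ C) < ν A - r := (h _).trans_lt hlt
    by_contra hcon
    have h3 : ν C ≤ r := not_lt.1 hcon
    have h4 : ν A < r + (ν A - r) :=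
      h1.trans_lt (ENNReal.add_lt_add_of_le_of_lt (measure_ne_top ν C) h3 h2)
    rw [add_tsub_cancel_of_le hr.le] at h4
    exact lt_irrefl _ h4
  infer_instance

variable (K) in
/-- `M(K)`: the complex vector space of all regular complex Borel measures on `K`, that is,
those whose total variation measure is (finite and) regular. -/
def M [T2Space K] : Submodule ℂ (ComplexMeasure K) where
  carrier := {c | IsFiniteMeasure (VectorMeasure.variation c) ∧
    (VectorMeasure.variation c).Regular}
  zero_mem' := by
    simp only [Set.mem_ofPred_eq, VectorMeasure.variation_zero]
    exact ⟨inferInstance, inferInstance⟩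
  add_mem' := by
    rintro a b ⟨ha, ha'⟩ ⟨hb, hb'⟩
    have hle := VectorMeasure.variation_add_le (μ := a) (ν := b)
    have : (VectorMeasure.variation a + VectorMeasure.variation b).Regular := by
      have : (VectorMeasure.variation a + VectorMeasure.variation b).InnerRegular := inferInstance
      infer_instance
    exact ⟨isFiniteMeasure_of_le _ hle, regular_of_le hle⟩
  smul_mem' := by
    rintro c a ⟨ha, ha'⟩
    simp only [Set.mem_ofPred_eq, VectorMeasure.variation_smul]
    exact ⟨inferInstance, inferInstance⟩

variable (K) in
/-- `M⁺(K)`: the finite non-negative regular Borel measures on `K`. -/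
def MPlus : Type _ := {μ : Measure K // IsFiniteMeasure μ ∧ μ.Regular}

namespace MPlus

/-- The underlying Borel measure. -/
def meas (μ : MPlus K) : Measure K := μ.1

instance (μ : MPlus K) : IsFiniteMeasure μ.meas := μ.2.1

instance (μ : MPlus K) : μ.meas.Regular := μ.2.2

/-- The inclusion of `M⁺(K)` into `M(K)`. -/
def toM [T2Space K] (μ : MPlus K) : M K :=
  ⟨μ.meas.toSignedMeasure.toComplexMeasure 0, by
    have hle : VectorMeasure.variation (μ.meas.toSignedMeasure.toComplexMeasure 0) ≤ μ.meas := by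
      refine VectorMeasure.variation_le_of_forall_enorm_le fun E hE => ?_
      have : (μ.meas.toSignedMeasure.toComplexMeasure 0) E = ((μ.meas.real E : ℝ) : ℂ) := by
        rw [SignedMeasure.toComplexMeasure_apply, Measure.toSignedMeasure_apply_measurable hE]
        rfl
      rw [this, ← ofReal_norm, Complex.norm_real, Real.norm_of_nonneg measureReal_nonneg]
      simp [measureReal_def]
    exact ⟨isFiniteMeasure_of_le _ hle, regular_of_le hle⟩⟩

/-- The cone topology on `M⁺(K)`: the weak topology induced by the non-negative compactly
supported continuous functions together with the constant function `1`. -/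
instance : TopologicalSpace (MPlus K) :=
  TopologicalSpace.induced
    (fun μ => ((fun f : C_c(K, ℝ≥0) => ∫ x, (f x : ℝ) ∂μ.meas), μ.meas.real Set.univ))
    inferInstance

/-- The point mass `p_x`. -/
def point [T2Space K] [LocallyCompactSpace K] (x : K) : MPlus K :=
  ⟨Measure.dirac x, inferInstance, by
    have : (Measure.dirac x).InnerRegular := by
      refine ⟨fun A hA r hr => ?_⟩
      by_cases hx : x ∈ A
      · refine ⟨{x}, by simpa using hx, isCompact_singleton, hr.trans_le ?_⟩
        simpa using (prob_le_one (μ := Measure.dirac x) (s := A))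
      · simp [Measure.dirac_apply' _ hA, hx] at hr
    infer_instance⟩

end MPlus

variable [T2Space K] [LocallyCompactSpace K]

/-! ### Integrals of bounded continuous functions depend continuously on a probability measure -/

section Narrow


variable {Y : Type*} [TopologicalSpace Y] {ρ : Y → MPlus K}

theorem continuous_integral_cc (hρ : Continuous ρ) (g : C_c(K, ℝ≥0)) :
    Continuous fun y => ∫ x, (g x : ℝ) ∂(ρ y).meas :=
  (continuous_apply g).comp (continuous_fst.comp (continuous_induced_dom.comp hρ))

theorem continuous_integral_nonneg (hρ : Continuous ρ)
    (hprob : ∀ y, IsProbabilityMeasure (ρ y).meas) {F : K → ℝ} (hF : Continuous F) {B : ℝ}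
    (h0 : ∀ x, 0 ≤ F x) (hB : ∀ x, F x ≤ B) :
    Continuous fun y => ∫ x, F x ∂(ρ y).meas := by
  have hFint : ∀ y, Integrable F (ρ y).meas := fun y =>
    Integrable.of_bound hF.aestronglyMeasurable B
      (Filter.Eventually.of_forall fun x => by rw [Real.norm_of_nonneg (h0 x)]; exact hB x)
  rw [continuous_iff_continuousAt]
  intro y₀
  have hBnn : 0 ≤ B := by
    obtain ⟨x⟩ : Nonempty K := nonempty_of_isProbabilityMeasure (ρ y₀).meas
    exact (h0 x).trans (hB x)
  rw [ContinuousAt, Metric.tendsto_nhds]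
  intro ε hε
  set δ : ℝ := ε / (4 * (B + 1)) with hδ
  have hδ0 : 0 < δ := by positivity
  obtain ⟨C, -, hC, hlt⟩ := (MeasurableSet.univ (α := K)).exists_isCompact_sdiff_lt
    (μ := (ρ y₀).meas) (measure_ne_top _ _) (ENNReal.ofReal_pos.2 hδ0).ne'
  obtain ⟨g, hg1, -, hgc, hg⟩ := exists_continuous_one_zero_of_isCompact hC isClosed_empty
    (Set.disjoint_empty C)
  have hgint : ∀ y, Integrable (fun x => g x) (ρ y).meas := fun y =>
    Integrable.of_bound g.continuous.aestronglyMeasurable 1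
      (Filter.Eventually.of_forall fun x => by
        rw [Real.norm_of_nonneg (hg x).1]; exact (hg x).2)
  have hgFint : ∀ y, Integrable (fun x => g x * F x) (ρ y).meas := fun y =>
    Integrable.of_bound (g.continuous.mul hF).aestronglyMeasurable B
      (Filter.Eventually.of_forall fun x => by
        rw [Real.norm_of_nonneg (mul_nonneg (hg x).1 (h0 x))]
        nlinarith [(hg x).1, (hg x).2, h0 x, hB x])
  let g₁ : C_c(K, ℝ≥0) := ⟨⟨fun x => (g x).toNNReal, by fun_prop⟩,
    hgc.comp_left (g := Real.toNNReal) Real.toNNReal_zero⟩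
  let g₂ : C_c(K, ℝ≥0) := ⟨⟨fun x => (g x * F x).toNNReal, by fun_prop⟩,
    (hgc.mul_right (f' := F)).comp_left (g := Real.toNNReal) Real.toNNReal_zero⟩
  have c₁ : Continuous fun y => ∫ x, g x ∂(ρ y).meas := by
    refine (continuous_integral_cc hρ g₁).congr fun y => integral_congr_ae ?_
    exact Filter.Eventually.of_forall fun x => Real.coe_toNNReal _ (hg x).1
  have c₂ : Continuous fun y => ∫ x, g x * F x ∂(ρ y).meas := by
    refine (continuous_integral_cc hρ g₂).congr fun y => integral_congr_ae ?_
    exact Filter.Eventually.of_forall fun x => Real.coe_toNNReal _ (mul_nonneg (hg x).1 (h0 x))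
  have hy₀ : 1 - δ < ∫ x, g x ∂(ρ y₀).meas := by
    have h1 : (ρ y₀).meas.real (Set.univ \ C) < δ := by
      rw [measureReal_def]
      exact (ENNReal.lt_ofReal_iff_toReal_lt (measure_ne_top _ _)).1 hlt
    have h2 : (ρ y₀).meas.real C + (ρ y₀).meas.real (Set.univ \ C) = 1 := by
      rw [← Set.compl_eq_univ_sdiff, measureReal_add_measureReal_compl hC.measurableSet]
      exact probReal_univ
    have h3 : (ρ y₀).meas.real C ≤ ∫ x, g x ∂(ρ y₀).meas := by
      rw [← integral_indicator_one hC.measurableSet]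
      refine integral_mono ((integrable_const (1 : ℝ)).indicator hC.measurableSet) (hgint y₀) ?_
      intro x
      by_cases hx : x ∈ C
      · simp [hx, hg1 hx]
      · simpa [hx] using (hg x).1
    linarith
  have key : ∀ y, |∫ x, F x ∂(ρ y).meas - ∫ x, g x * F x ∂(ρ y).meas|
      ≤ B * (1 - ∫ x, g x ∂(ρ y).meas) := by
    intro y
    have hp := hprob y
    rw [← integral_sub (hFint y) (hgFint y), abs_of_nonneg]
    · have : B * (1 - ∫ x, g x ∂(ρ y).meas) = ∫ x, B * (1 - g x) ∂(ρ y).meas := by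
        rw [integral_const_mul, integral_sub (integrable_const _) (hgint y)]
        simp
      rw [this]
      refine integral_mono ((hFint y).sub (hgFint y))
        (((integrable_const (1 : ℝ)).sub (hgint y)).const_mul B) fun x => ?_
      change F x - g x * F x ≤ B * (1 - g x)
      nlinarith [(hg x).1, (hg x).2, h0 x, hB x]
    · refine integral_nonneg fun x => ?_
      simp only [Pi.zero_apply]
      nlinarith [(hg x).1, (hg x).2, h0 x, hB x]
  have hBδ : B * δ ≤ ε / 4 := by
    rw [hδ, ← mul_div_assoc, div_le_div_iff₀ (by positivity) (by norm_num)]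
    nlinarith
  have e₁ : ∀ᶠ y in 𝓝 y₀, 1 - δ < ∫ x, g x ∂(ρ y).meas :=
    (c₁.continuousAt (x := y₀)).eventually (lt_mem_nhds hy₀)
  have e₂ := Metric.tendsto_nhds.1 (c₂.continuousAt (x := y₀)) (ε / 2) (by positivity)
  filter_upwards [e₁, e₂] with y h₁ h₂
  rw [Real.dist_eq] at h₂ ⊢
  have k₁ := key y
  have k₂ := key y₀
  have b₁ : B * (1 - ∫ x, g x ∂(ρ y).meas) ≤ B * δ :=
    mul_le_mul_of_nonneg_left (by linarith) hBnn
  have b₂ : B * (1 - ∫ x, g x ∂(ρ y₀).meas) ≤ B * δ :=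
    mul_le_mul_of_nonneg_left (by linarith) hBnn
  rw [abs_lt] at h₂ ⊢
  rw [abs_le] at k₁ k₂
  constructor <;> linarith [h₂.1, h₂.2, k₁.1, k₁.2, k₂.1, k₂.2]

theorem continuous_integral_real (hρ : Continuous ρ)
    (hprob : ∀ y, IsProbabilityMeasure (ρ y).meas) {F : K → ℝ} (hF : Continuous F) {B : ℝ}
    (hB : ∀ x, |F x| ≤ B) : Continuous fun y => ∫ x, F x ∂(ρ y).meas := by
  have h := continuous_integral_nonneg hρ hprob (F := fun x => F x + B) (B := 2 * B)
    (hF.add continuous_const) (fun x => by linarith [(abs_le.1 (hB x)).1])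
    (fun x => by linarith [(abs_le.1 (hB x)).2])
  refine (h.sub (continuous_const (y := B))).congr fun y => ?_
  have := hprob y
  change ∫ x, (F x + B) ∂(ρ y).meas - B = _
  rw [integral_add (Integrable.of_bound hF.aestronglyMeasurable B
    (Filter.Eventually.of_forall hB)) (integrable_const _)]
  simp

theorem continuous_integral_complex (hρ : Continuous ρ)
    (hprob : ∀ y, IsProbabilityMeasure (ρ y).meas) (f : K →ᵇ ℂ) :
    Continuous fun y => ∫ x, f x ∂(ρ y).meas := by
  have hint : ∀ y, Integrable (fun x => f x) (ρ y).meas := fun y => f.integrable _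
  have hre := continuous_integral_real hρ hprob (F := fun x => (f x).re) (B := ‖f‖)
    (by fun_prop) fun x => (Complex.abs_re_le_norm _).trans (f.norm_coe_le_norm x)
  have him := continuous_integral_real hρ hprob (F := fun x => (f x).im) (B := ‖f‖)
    (by fun_prop) fun x => (Complex.abs_im_le_norm _).trans (f.norm_coe_le_norm x)
  refine ((Complex.continuous_ofReal.comp hre).add
    ((Complex.continuous_ofReal.comp him).mul (continuous_const (y := Complex.I)))).congr fun y => ?_
  exact integral_re_add_im (𝕜 := ℂ) (hint y)

end Narrow

theorem MPlus.continuous_point : Continuous (MPlus.point : K → MPlus K) := by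
  refine continuous_induced_rng.2 (Continuous.prodMk (continuous_pi fun f => ?_) ?_)
  · have : (fun x : K => ∫ z, (f z : ℝ) ∂(MPlus.point x).meas) = fun x => (f x : ℝ) := by
      funext x
      exact integral_dirac _ _
    change Continuous fun x : K => ∫ z, (f z : ℝ) ∂(MPlus.point x).meas
    rw [this]
    fun_prop
  · have : (fun x : K => (MPlus.point x).meas.real Set.univ) = fun _ => 1 := by
      funext x
      simp [MPlus.point, MPlus.meas]
    change Continuous fun x : K => (MPlus.point x).meas.real Set.univ
    rw [this]
    exact continuous_const

/-! ### Semitopological semihypergroups -/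

variable (K) in
/-- A semitopological semihypergroup structure on the locally compact Hausdorff space `K`. -/
structure SemitopologicalSemihypergroup where
  /-- The convolution, a bilinear operation on `M(K)`. -/
  conv : M K →ₗ[ℂ] M K →ₗ[ℂ] M K
  /-- `(M(K), *)` is an associative algebra. -/
  conv_assoc : ∀ μ ν ω, conv (conv μ ν) ω = conv μ (conv ν ω)
  /-- The convolution is positive: it restricts to an operation on `M⁺(K)`. -/
  convPlus : MPlus K → MPlus K → MPlus K
  toM_convPlus : ∀ μ ν, (convPlus μ ν).toM = conv μ.toM ν.toM
  /-- On `M⁺(K)`, with the cone topology, the convolution is separately continuous. -/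
  continuous_convPlus_left : ∀ ω, Continuous fun μ => convPlus ω μ
  continuous_convPlus_right : ∀ ω, Continuous fun μ => convPlus μ ω
  /-- `p_x * p_y` is a probability measure with compact support. -/
  isProbabilityMeasure_point : ∀ x y,
    IsProbabilityMeasure (convPlus (MPlus.point x) (MPlus.point y)).meas
  isCompact_support : ∀ x y,
    IsCompact (convPlus (MPlus.point x) (MPlus.point y)).meas.support
  /-- `(x, y) ↦ supp (p_x * p_y)` is continuous into the compact subsets of `K` with the
  Michael (Vietoris) topology. -/
  continuous_support : Continuous[inferInstance, TopologicalSpace.vietoris K]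
    fun q : K × K => (convPlus (MPlus.point q.1) (MPlus.point q.2)).meas.support

namespace SemitopologicalSemihypergroup

variable (S : SemitopologicalSemihypergroup K)

/-- The measure `p_x * p_y`. -/
def pconv (x y : K) : Measure K := (S.convPlus (MPlus.point x) (MPlus.point y)).meas

instance (x y : K) : IsProbabilityMeasure (S.pconv x y) := S.isProbabilityMeasure_point x y

/-- `e` is a two-sided identity: `p_x * p_e = p_e * p_x = p_x` for all `x`. -/
def IsIdentity (e : K) : Prop :=
  ∀ x, S.pconv x e = Measure.dirac x ∧ S.pconv e x = Measure.dirac x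

/-- The left translation `f ↦ L_x f`, `L_x f y = ∫ f d(p_x * p_y)`, on bounded continuous
functions. -/
def leftTranslate (x : K) : (K →ᵇ ℂ) →ₗ[ℂ] (K →ᵇ ℂ) where
  toFun f := BoundedContinuousFunction.ofNormedAddCommGroup (fun y => ∫ z, f z ∂(S.pconv x y))
    (continuous_integral_complex ((S.continuous_convPlus_left (MPlus.point x)).comp
      MPlus.continuous_point) (fun y => S.isProbabilityMeasure_point x y) f) ‖f‖
    (fun y => by
      refine (norm_integral_le_of_norm_le_const (μ := S.pconv x y)
        (Filter.Eventually.of_forall fun z => f.norm_coe_le_norm z)).trans ?_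
      simp)
  map_add' f g := by
    ext y
    exact integral_add (f.integrable (S.pconv x y)) (g.integrable (S.pconv x y))
  map_smul' c f := by
    ext y
    exact integral_const_mul c _

theorem leftTranslate_apply (x : K) (f : K →ᵇ ℂ) (y : K) :
    S.leftTranslate x f y = ∫ z, f z ∂(S.pconv x y) := rfl

theorem leftTranslate_one (x : K) : S.leftTranslate x 1 = 1 := by
  ext y
  simp [leftTranslate_apply]

/-- `AP(K)`: the space of almost periodic functions, i.e. of the bounded continuous functions `f`
whose (left) orbit `{L_x f : x ∈ K}` is relatively compact in `C(K)` with the supremum norm. -/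
def AP : Submodule ℂ (K →ᵇ ℂ) where
  carrier := {f | IsCompact (closure (Set.range fun x => S.leftTranslate x f))}
  zero_mem' := by
    refine isCompact_singleton (x := (0 : K →ᵇ ℂ)) |>.of_isClosed_subset isClosed_closure
      (closure_minimal ?_ isClosed_singleton)
    rintro _ ⟨x, rfl⟩
    simp
  add_mem' := by
    intro f g hf hg
    have h := hf.add hg
    refine h.of_isClosed_subset isClosed_closure (closure_minimal ?_ h.isClosed)
    rintro _ ⟨x, rfl⟩
    simp only [map_add]
    exact Set.add_mem_add (subset_closure ⟨x, rfl⟩) (subset_closure ⟨x, rfl⟩)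
  smul_mem' := by
    intro c f hf
    have h := hf.image (continuous_const_smul c)
    refine h.of_isClosed_subset isClosed_closure (closure_minimal ?_ h.isClosed)
    rintro _ ⟨x, rfl⟩
    simp only [map_smul]
    exact ⟨_, subset_closure ⟨x, rfl⟩, rfl⟩

theorem one_mem_AP : (1 : K →ᵇ ℂ) ∈ S.AP := by
  refine isCompact_singleton (x := (1 : K →ᵇ ℂ)) |>.of_isClosed_subset isClosed_closure
    (closure_minimal ?_ isClosed_singleton)
  rintro _ ⟨x, rfl⟩
  simp [leftTranslate_one]

/-- A left invariant mean on `AP(K)`: a functional `m ∈ AP(K)*` with `‖m‖ = m 1 = 1` and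
`m (L_x f) = m f`. (As `AP(K)` is translation invariant, `L_x f` always lies in `AP(K)`; the element
`g` is `L_x f` seen as an element of `AP(K)`.) -/
structure IsLeftInvariantMean (m : S.AP →L[ℂ] ℂ) : Prop where
  norm_eq_one : ‖m‖ = 1
  map_one : m ⟨1, S.one_mem_AP⟩ = 1
  map_leftTranslate : ∀ (x : K) (f g : S.AP),
    (g : K →ᵇ ℂ) = S.leftTranslate x (f : K →ᵇ ℂ) → m g = m f

/-- `AP(K)` is left amenable: it admits a left invariant mean. -/
def IsLeftAmenableAP : Prop := ∃ m : S.AP →L[ℂ] ℂ, S.IsLeftInvariantMean m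

/-! ### Actions -/

/-- A separately continuous action of `K` on a subset `C` of a locally convex space `E`. The
identity `π(s, π(t, x)) = ∫ π(ζ, x) d(p_s * p_t)(ζ)` is an identity between vectors of `E`; the
vector-valued integral is the weak one, tested by the continuous linear functionals on `E`. -/
structure SepContAction {E : Type*} [AddCommGroup E] [Module ℝ E] [TopologicalSpace E]
    (C : Set E) where
  /-- The map `π : K × C → C`. -/
  act : K → C → C
  act_act : ∀ (s t : K) (x : C) (l : E →L[ℝ] ℝ),
    l (act s (act t x) : E) = ∫ z, l (act z x : E) ∂(S.pconv s t)
  act_identity : ∀ e, S.IsIdentity e → ∀ x, act e x = x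
  continuous_act : ∀ s, Continuous (act s)
  continuous_orbit : ∀ x, Continuous fun s => act s x

variable {S}

/-- The action is non-expansive with respect to every seminorm of the family `Q`. -/
def SepContAction.IsNonexpansive {E : Type*} [AddCommGroup E] [Module ℝ E] [TopologicalSpace E]
    {C : Set E} (π : S.SepContAction C) (Q : Set (Seminorm ℝ E)) : Prop :=
  ∀ p ∈ Q, ∀ (s : K) (x y : C), p ((π.act s x : E) - π.act s y) ≤ p ((x : E) - y)

/-- `x` is a common fixed point of the action. -/
def SepContAction.IsCommonFixedPoint {E : Type*} [AddCommGroup E] [Module ℝ E]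
    [TopologicalSpace E] {C : Set E} (π : S.SepContAction C) (x : C) : Prop :=
  ∀ s, π.act s x = x

end SemitopologicalSemihypergroup
end Semihyper
end

/- A left invariant mean on `AP(K)`, evaluated along the orbit of a point `y`, gives a functional
`M` on `C(C, ℝ)` that sees only this orbit, fixes constants, and, for each continuous functional
`l`, takes the same value at `l ∘ γ` for all `γ` in the closed convex hull of the maps `π(s, ·)`.
This hull is a compact semigroup of non-expansive maps, and DeMarr's argument yields `j` in it and
`y` with `j (γ y) = y` for all `γ`. Comparing `M (l ∘ j)` with `M (l ∘ π(t, ·) ∘ j)` gives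
`l y = l (π(t, y))`.

Conversely, `K` acts on the weak-* compact convex set of means by `φ ↦ φ ∘ L_s`. Recording each
orbit `x ↦ φ (L_x f)` as an element of a normed space keeps this set compact, by almost periodicity,
and makes the action non-expansive; a common fixed point is a left invariant mean. -/

noncomputable section

namespace Semihyper

section WeakIntegral

variable {X : Type*} [MeasurableSpace X] {μ : Measure X}
  {E : Type*} [AddCommGroup E] [Module ℝ E] [TopologicalSpace E]

/-- `w` is the weak (Pettis) integral of `G` against `μ`: every continuous linear functional `l` has
`l ∘ G` integrable with integral `l w`. Integrability is part of the definition, since the Bochner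
integral of a non-integrable function is `0`. -/
def IsWeakIntegral (μ : Measure X) (G : X → E) (w : E) : Prop :=
  ∀ l : E →L[ℝ] ℝ, Integrable (fun z => l (G z)) μ ∧ l w = ∫ z, l (G z) ∂μ

theorem isWeakIntegral_integral {V : Type*} [NormedAddCommGroup V] [NormedSpace ℝ V]
    [CompleteSpace V] {G : X → V} (hG : Integrable G μ) : IsWeakIntegral μ G (∫ z, G z ∂μ) :=
  fun l => ⟨l.integrable_comp hG, (l.integral_comp_comm hG).symm⟩

theorem exists_eq_sum_apply {ι : Type*} {V : ι → Type*} [∀ i, AddCommGroup (V i)]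
    [∀ i, Module ℝ (V i)] [∀ i, TopologicalSpace (V i)] (l : (∀ i, V i) →L[ℝ] ℝ) :
    ∃ (F : Finset ι) (L : ∀ i, V i →L[ℝ] ℝ), ∀ v, l v = ∑ i ∈ F, L i (v i) := by
  classical
  have hnhds : l ⁻¹' Metric.ball 0 1 ∈ 𝓝 (0 : ∀ i, V i) :=
    l.continuous.continuousAt.preimage_mem_nhds (by simp [Metric.ball_mem_nhds])
  rw [nhds_pi, Filter.mem_pi] at hnhds
  obtain ⟨I, hI, t, ht, hsub⟩ := hnhds
  have hzero : ∀ v : ∀ i, V i, (∀ i ∈ I, v i = 0) → l v = 0 := by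
    intro v hv
    by_contra hne
    have hmem : (l v)⁻¹ • v ∈ l ⁻¹' Metric.ball 0 1 := hsub fun i hi => by
      simpa [hv i hi] using mem_of_mem_nhds (ht i)
    simp [hne] at hmem
  refine ⟨hI.toFinset, fun i => l.comp (.single ℝ V i), fun v => ?_⟩
  change l v = ∑ i ∈ hI.toFinset, l (Pi.single i (v i))
  rw [← map_sum, ← sub_eq_zero, ← map_sub]
  refine hzero _ fun i hi => ?_
  rw [Pi.sub_apply, Finset.sum_apply, Finset.sum_pi_single, if_pos (hI.mem_toFinset.2 hi), sub_self]

theorem IsWeakIntegral.pi {ι : Type*} {V : ι → Type*} [∀ i, AddCommGroup (V i)]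
    [∀ i, Module ℝ (V i)] [∀ i, TopologicalSpace (V i)] {G : X → ∀ i, V i} {w : ∀ i, V i}
    (h : ∀ i, IsWeakIntegral μ (fun z => G z i) (w i)) : IsWeakIntegral μ G w := by
  intro l
  obtain ⟨F, L, hL⟩ := exists_eq_sum_apply l
  simp only [hL]
  exact ⟨integrable_finsetSum F fun i _ => (h i (L i)).1,
    (Finset.sum_congr rfl fun i _ => (h i (L i)).2).trans
      (integral_finsetSum F fun i _ => (h i (L i)).1).symm⟩

theorem IsWeakIntegral.prodMk {F : Type*} [AddCommGroup F] [Module ℝ F] [TopologicalSpace F]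
    {G : X → E} {H : X → F} {v : E} {w : F} (hG : IsWeakIntegral μ G v)
    (hH : IsWeakIntegral μ H w) : IsWeakIntegral μ (fun z => (G z, H z)) (v, w) := by
  intro l
  obtain ⟨hG₁, hG₂⟩ := hG (l.comp (.inl ℝ E F))
  obtain ⟨hH₁, hH₂⟩ := hH (l.comp (.inr ℝ E F))
  simp only [← l.comp_inl_add_comp_inr]
  exact ⟨hG₁.add hH₁, (congrArg₂ (· + ·) hG₂ hH₂).trans (integral_add hG₁ hH₁).symm⟩

theorem IsWeakIntegral.mem_closedConvexHull [IsTopologicalAddGroup E] [ContinuousSMul ℝ E]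
    [LocallyConvexSpace ℝ E] [IsProbabilityMeasure μ] {G : X → E} {w : E}
    (h : IsWeakIntegral μ G w) : w ∈ closedConvexHull ℝ (Set.range G) := by
  by_contra hw
  obtain ⟨l, c, hl, hc⟩ := geometric_hahn_banach_closed_point
    convex_closedConvexHull isClosed_closedConvexHull hw
  obtain ⟨hint, hlw⟩ := h l
  have hle : ∫ z, l (G z) ∂μ ≤ ∫ _, c ∂μ :=
    integral_mono hint (integrable_const c) fun z => (hl _ (subset_closedConvexHull ⟨z, rfl⟩)).le
  rw [← hlw, integral_const, probReal_univ, one_smul] at hle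
  exact hc.not_ge hle

end WeakIntegral

theorem integrable_of_continuous_of_forall_mem {X V : Type*} [TopologicalSpace X]
    [MeasurableSpace X] [OpensMeasurableSpace X] [NormedAddCommGroup V] (μ : Measure X)
    [IsFiniteMeasure μ] {G : X → V} (hG : Continuous G) {A : Set V} (hA : IsCompact A)
    (hGA : ∀ z, G z ∈ A) : Integrable G μ := by
  borelize V
  obtain ⟨B, hB⟩ := hA.isBounded.exists_norm_le
  have hmeas : StronglyMeasurable G := stronglyMeasurable_iff_measurable_separable.2
    ⟨hG.measurable, hA.isSeparable.mono (Set.range_subset_iff.2 hGA)⟩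
  exact .of_bound hmeas.aestronglyMeasurable B (.of_forall fun z => hB _ (hGA z))

theorem continuous_continuousMap_of_equicontinuous {Z X α : Type*} [TopologicalSpace Z]
    [TopologicalSpace X] [CompactSpace X] [UniformSpace α] {F : Z → C(X, α)}
    (hF : Equicontinuous fun z x => F z x) (hpt : ∀ x, Continuous fun z => F z x) :
    Continuous F := by
  refine continuous_iff_continuousAt.2 fun z₀ => ?_
  have hpi : Filter.Tendsto (fun z x => F z x) (𝓝 z₀) (𝓝 fun x => F z₀ x) :=
    tendsto_pi_nhds.2 fun x => (hpt x).continuousAt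
  exact ContinuousMap.tendsto_iff_tendstoUniformly.2 <|
    UniformFun.tendsto_iff_tendstoUniformly.1 <|
      (hF.tendsto_uniformFun_iff_pi _ _).2 hpi

theorem eq_of_mem_closedConvexHull {V W : Type*} [AddCommGroup V] [Module ℝ V]
    [TopologicalSpace V] [AddCommGroup W] [Module ℝ W] [TopologicalSpace W] [T1Space W] {s : Set V}
    {F : closedConvexHull ℝ s → W} (hF : Continuous F)
    (haff : ∀ (a b : ℝ) (x y z : closedConvexHull ℝ s), 0 ≤ a → 0 ≤ b → a + b = 1 →
      (z : V) = a • (x : V) + b • (y : V) → F z = a • F x + b • F y) {c : W}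
    (hs : ∀ (x : V) (hx : x ∈ s), F ⟨x, subset_closedConvexHull hx⟩ = c)
    (x : closedConvexHull ℝ s) : F x = c := by
  have hclosed : IsClosed (Subtype.val '' {y | F y = c}) :=
    isClosed_closedConvexHull.isClosedEmbedding_subtypeVal.isClosedMap _
      (isClosed_singleton.preimage hF)
  have hconvex : Convex ℝ (Subtype.val '' {y | F y = c}) := by
    rintro _ ⟨y, hy, rfl⟩ _ ⟨z, hz, rfl⟩ a b ha hb hab
    refine ⟨⟨_, convex_closedConvexHull y.2 z.2 ha hb hab⟩, ?_, rfl⟩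
    rw [Set.mem_ofPred_eq, haff a b y z _ ha hb hab rfl, hy.out, hz.out, ← add_smul, hab, one_smul]
  have hsub : s ⊆ Subtype.val '' {y | F y = c} :=
    fun y hy => ⟨⟨y, subset_closedConvexHull hy⟩, hs y hy, rfl⟩
  obtain ⟨y, hy, hyx⟩ := closedConvexHull_min hsub hconvex hclosed x.2
  rwa [← Subtype.ext hyx]

theorem mapsTo_closedConvexHull {E : Type*} [AddCommGroup E] [Module ℝ E] [TopologicalSpace E]
    (T : E →L[ℝ] E) {s : Set E} (hT : Set.MapsTo T s (closedConvexHull ℝ s)) :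
    Set.MapsTo T (closedConvexHull ℝ s) (closedConvexHull ℝ s) :=
  closedConvexHull_min hT (convex_closedConvexHull.linear_preimage T.toLinearMap)
    (isClosed_closedConvexHull.preimage T.continuous)

section Nonexpansive

variable {E : Type*} [AddCommGroup E] [Module ℝ E] {Q : Set (Seminorm ℝ E)} {C : Set E}

/-- The maps `C → E` that are non-expansive for each seminorm in `Q`. A self-map `γ` of `C` is
called non-expansive when `Subtype.val ∘ γ` belongs to this set. -/
def nonexpansiveMaps (Q : Set (Seminorm ℝ E)) (C : Set E) : Set (C → E) :=
  {γ | ∀ p ∈ Q, ∀ x y : C, p (γ x - γ y) ≤ p ((x : E) - y)}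

theorem subtypeVal_mem_nonexpansiveMaps : Subtype.val ∈ nonexpansiveMaps Q C :=
  fun _ _ _ _ => le_rfl

theorem convex_nonexpansiveMaps : Convex ℝ (nonexpansiveMaps Q C) := by
  intro γ hγ δ hδ a b ha hb hab p hp x y
  have hball := p.convex_closedBall 0 (p ((x : E) - y))
    (p.mem_closedBall_zero.2 (hγ p hp x y)) (p.mem_closedBall_zero.2 (hδ p hp x y)) ha hb hab
  rw [p.mem_closedBall_zero] at hball
  convert hball using 2
  simp only [Pi.add_apply, Pi.smul_apply, smul_sub]
  abel

variable [TopologicalSpace E]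

theorem isClosed_nonexpansiveMaps (hQ : WithSeminorms (fun p : Q => (p : Seminorm ℝ E))) :
    IsClosed (nonexpansiveMaps Q C) := by
  have := hQ.topologicalAddGroup
  simp only [nonexpansiveMaps, Set.ofPred_forall]
  refine isClosed_biInter fun p hp => isClosed_iInter fun x => isClosed_iInter fun y => ?_
  exact isClosed_le ((hQ.continuous_seminorm ⟨p, hp⟩).comp
    ((continuous_apply x).sub (continuous_apply y))) continuous_const

theorem eventually_forall_nonexpansiveMaps_sub_mem
    (hQ : WithSeminorms (fun p : Q => (p : Seminorm ℝ E))) {U : Set E} (hU : U ∈ 𝓝 0) (x₀ : C) :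
    ∀ᶠ x in 𝓝 x₀, ∀ γ ∈ nonexpansiveMaps Q C, γ x - γ x₀ ∈ U := by
  have := hQ.topologicalAddGroup
  obtain ⟨⟨F, r⟩, hr, hsub⟩ := hQ.hasBasis_zero_ball.mem_iff.1 hU
  rw [Seminorm.ball_finset_sup_eq_iInter _ _ _ hr] at hsub
  have hnear (p : Q) : ∀ᶠ x : C in 𝓝 x₀, (p : Seminorm ℝ E) ((x : E) - x₀) < r := by
    have hcont : Continuous fun x : C => (p : Seminorm ℝ E) ((x : E) - x₀) :=
      (hQ.continuous_seminorm p).comp (continuous_subtype_val.sub continuous_const)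
    exact hcont.continuousAt.eventually (gt_mem_nhds (by simpa using hr))
  filter_upwards [(Filter.eventually_all_finset F).2 fun p _ => hnear p] with x hx γ hγ
  refine hsub (Set.mem_iInter₂.2 fun p hp => ?_)
  exact (p : Seminorm ℝ E).mem_ball_zero.2 ((hγ p p.2 x x₀).trans_lt (hx p hp))

theorem continuous_of_mem_nonexpansiveMaps
    (hQ : WithSeminorms (fun p : Q => (p : Seminorm ℝ E))) {γ : C → E}
    (hγ : γ ∈ nonexpansiveMaps Q C) : Continuous γ := by
  have := hQ.topologicalAddGroup
  refine continuous_iff_continuousAt.2 fun x₀ => tendsto_sub_nhds_zero_iff.1 fun U hU => ?_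
  exact (eventually_forall_nonexpansiveMaps_sub_mem hQ hU x₀).mono fun x hx => hx γ hγ

theorem equicontinuous_apply_nonexpansiveMaps
    (hQ : WithSeminorms (fun p : Q => (p : Seminorm ℝ E))) (l : E →L[ℝ] ℝ) :
    Equicontinuous fun (γ : nonexpansiveMaps Q C) (x : C) => l (γ.1 x) := by
  refine fun x₀ => Metric.equicontinuousAt_iff_right.2 fun ε hε => ?_
  have hU : l ⁻¹' Metric.ball 0 ε ∈ 𝓝 0 :=
    l.continuous.continuousAt.preimage_mem_nhds (by simp [Metric.ball_mem_nhds, hε])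
  filter_upwards [eventually_forall_nonexpansiveMaps_sub_mem hQ hU x₀] with x hx γ
  have hsmall := hx γ γ.2
  rwa [Set.mem_preimage, mem_ball_zero_iff, map_sub, ← dist_eq_norm, dist_comm] at hsmall

end Nonexpansive

section CompactSemigroup

variable {X : Type*} [TopologicalSpace X] [T2Space X]

theorem exists_minimal_isCompact {P : Set X → Prop}
    (hP : ∀ c : Set (Set X), c.Nonempty → (∀ s ∈ c, P s) → P (⋂₀ c)) {s : Set X}
    (hs : IsCompact s) (hne : s.Nonempty) (hPs : P s) :
    ∃ m ⊆ s, Minimal (fun t => IsCompact t ∧ t.Nonempty ∧ P t) m := by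
  refine zorn_superset_nonempty {t | IsCompact t ∧ t.Nonempty ∧ P t} (fun c hc hchain hcne => ?_)
    s ⟨hs, hne, hPs⟩
  have hclosed : ∀ t ∈ c, IsClosed t := fun t ht => (hc ht).1.isClosed
  have : Nonempty c := hcne.to_subtype
  refine ⟨⋂₀ c, ⟨?_, ?_, hP c hcne fun t ht => (hc ht).2.2⟩,
    fun t ht => Set.sInter_subset_of_mem ht⟩
  · obtain ⟨t, ht⟩ := hcne
    exact (hc ht).1.of_isClosed_subset (isClosed_sInter hclosed) (Set.sInter_subset_of_mem ht)
  · exact IsCompact.nonempty_sInter_of_directed_nonempty_isCompact_isClosed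
      (fun a ha b hb => (hchain.total ha hb).elim (fun h => ⟨a, ha, subset_rfl, h⟩)
        fun h => ⟨b, hb, h, subset_rfl⟩) (fun t ht => (hc ht).2.1) (fun t ht => (hc ht).1) hclosed

theorem exists_isCompact_right_ideal {Γ : Set (X → X)} (hΓ : IsCompact Γ) (hne : Γ.Nonempty)
    (hmul : ∀ f ∈ Γ, ∀ g ∈ Γ, f ∘ g ∈ Γ) (hcont : ∀ f ∈ Γ, Continuous f) :
    ∃ J ⊆ Γ, IsCompact J ∧ J.Nonempty ∧ (∀ j ∈ J, ∀ g ∈ Γ, j ∘ g ∈ J) ∧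
      ∀ j ∈ J, (j ∘ ·) '' J = J := by
  obtain ⟨J, hJΓ, hmin⟩ := exists_minimal_isCompact (P := fun s => ∀ j ∈ s, ∀ g ∈ Γ, j ∘ g ∈ s)
    (fun c _ hc j hj g hg s hs => hc s hs j (hj s hs) g hg) hΓ hne hmul
  obtain ⟨hJc, hJne, hJ⟩ := hmin.prop
  refine ⟨J, hJΓ, hJc, hJne, hJ, fun j hj => ?_⟩
  have hsub : (j ∘ ·) '' J ⊆ J := Set.image_subset_iff.2 fun g hg => hJ j hj g (hJΓ hg)
  have hleft : Continuous fun g : X → X => j ∘ g :=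
    continuous_pi fun x => (hcont j (hJΓ hj)).comp (continuous_apply x)
  refine hsub.antisymm (hmin.le_of_le ⟨hJc.image hleft, hJne.image _, ?_⟩ hsub)
  rintro _ ⟨g, hg, rfl⟩ h hh
  exact ⟨g ∘ h, hJ g hg h hh, rfl⟩

end CompactSemigroup

section DeMarr

variable {E : Type*} [AddCommGroup E] [Module ℝ E] {C : Set E} {J : Set (C → C)} {D : Set E}

/-- `D` is a convex subset of `C` mapped into itself by every map in `J`. -/
structure IsInvariantConvex (J : Set (C → C)) (D : Set E) : Prop where
  subset : D ⊆ C
  convex : Convex ℝ D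
  apply_mem : ∀ j ∈ J, ∀ x : C, (x : E) ∈ D → (j x : E) ∈ D

theorem IsInvariantConvex.sInter {c : Set (Set E)} (hne : c.Nonempty)
    (hc : ∀ s ∈ c, IsInvariantConvex J s) : IsInvariantConvex J (⋂₀ c) where
  subset := (Set.sInter_subset_of_mem hne.some_mem).trans (hc _ hne.some_mem).subset
  convex := convex_sInter fun s hs => (hc s hs).convex
  apply_mem j hj x hx s hs := (hc s hs).apply_mem j hj x (hx s hs)

theorem IsInvariantConvex.inter_closedBall (hD : IsInvariantConvex J D) {p : Seminorm ℝ E}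
    (hJ : ∀ j ∈ J, ∀ x y : C, p ((j x : E) - j y) ≤ p ((x : E) - y)) {M : Set C}
    (hM : ∀ j ∈ J, M ⊆ j '' M) (r : ℝ) :
    IsInvariantConvex J (D ∩ ⋂ y ∈ M, p.closedBall (y : E) r) where
  subset := Set.inter_subset_left.trans hD.subset
  convex := hD.convex.inter (convex_iInter₂ fun y _ => p.convex_closedBall y r)
  apply_mem j hj x hx := by
    refine ⟨hD.apply_mem j hj x hx.1, Set.mem_iInter₂.2 fun y hy => ?_⟩
    obtain ⟨y', hy', rfl⟩ := hM j hj hy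
    exact (hJ j hj x y').trans (Set.mem_iInter₂.1 hx.2 y' hy')

variable [TopologicalSpace E]

/-- DeMarr's lemma. The centre is the average of a finite `d / 2`-net: at least one point of the net
is within `d / 2` of a given `y ∈ M`. -/
theorem exists_center_lt_diam [IsTopologicalAddGroup E] {M : Set E} (hM : IsCompact M)
    (hne : M.Nonempty) {p : Seminorm ℝ E} (hp : Continuous p) {d : ℝ} (hd : 0 < d)
    (hdiam : ∀ x ∈ M, ∀ y ∈ M, p (x - y) ≤ d) :
    ∃ u ∈ convexHull ℝ M, ∃ r < d, ∀ y ∈ M, p (u - y) ≤ r := by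
  classical
  obtain ⟨t, htM, hcov⟩ := hM.elim_nhds_subcover (fun x => {y | p (x - y) < d / 2}) fun x _ =>
    (isOpen_lt (hp.comp (continuous_const.sub continuous_id)) continuous_const).mem_nhds
      (by simpa using hd)
  have htne : t.Nonempty := by
    obtain ⟨i, hi, -⟩ := Set.mem_iUnion₂.1 (hcov hne.some_mem)
    exact ⟨i, hi⟩
  have hn : (0 : ℝ) < t.card := by exact_mod_cast htne.card_pos
  have hsum : ∑ _i ∈ t, (t.card : ℝ)⁻¹ = 1 := by
    rw [Finset.sum_const, nsmul_eq_mul, mul_inv_cancel₀ hn.ne']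
  have hr : 0 < (t.card : ℝ)⁻¹ * (d / 2) := by positivity
  refine ⟨∑ i ∈ t, (t.card : ℝ)⁻¹ • i, (convex_convexHull ℝ M).sum_mem (fun _ _ => by positivity)
    hsum fun i hi => subset_convexHull ℝ M (htM i hi), d - (t.card : ℝ)⁻¹ * (d / 2), by linarith,
    fun y hy => ?_⟩
  obtain ⟨j, hj, hjy⟩ := Set.mem_iUnion₂.1 (hcov hy)
  have hbound : ∀ i ∈ t, p (i - y) ≤ d - if i = j then d / 2 else 0 := by
    intro i hi
    split_ifs with hij
    · subst hij
      linarith [show p (i - y) < d / 2 from hjy]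
    · simpa using hdiam i (htM i hi) y hy
  calc p (∑ i ∈ t, (t.card : ℝ)⁻¹ • i - y)
      = p ((t.card : ℝ)⁻¹ • ∑ i ∈ t, (i - y)) := by
        rw [Finset.sum_sub_distrib, smul_sub, Finset.smul_sum, Finset.smul_sum, ← Finset.sum_smul,
          hsum, one_smul]
    _ = (t.card : ℝ)⁻¹ * p (∑ i ∈ t, (i - y)) := by
        rw [map_smul_eq_mul, Real.norm_of_nonneg (by positivity)]
    _ ≤ (t.card : ℝ)⁻¹ * ∑ i ∈ t, p (i - y) := by
        gcongr
        exact Finset.le_sum_of_subadditive p (map_zero p).le (map_add_le_add p) _ _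
    _ ≤ (t.card : ℝ)⁻¹ * ∑ i ∈ t, (d - if i = j then d / 2 else 0) := by
        gcongr with i hi
        exact hbound i hi
    _ = d - (t.card : ℝ)⁻¹ * (d / 2) := by
        rw [Finset.sum_sub_distrib, Finset.sum_ite_eq' t j, if_pos hj, Finset.sum_const,
          nsmul_eq_mul, mul_sub, inv_mul_cancel_left₀ hn.ne']

theorem seminorm_sub_eq_zero_of_minimal [IsTopologicalAddGroup E]
    (hD : Minimal (fun s => IsCompact s ∧ s.Nonempty ∧ IsInvariantConvex J s) D)
    {p : Seminorm ℝ E} (hp : Continuous p)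
    (hJ : ∀ j ∈ J, ∀ x y : C, p ((j x : E) - j y) ≤ p ((x : E) - y)) {M : Set C}
    (hMc : IsCompact M) (hMD : Subtype.val '' M ⊆ D) (hM : ∀ j ∈ J, M ⊆ j '' M)
    {y z : C} (hy : y ∈ M) (hz : z ∈ M) : p ((y : E) - z) = 0 := by
  have hpc : Continuous fun q : C × C => p ((q.1 : E) - q.2) := by fun_prop
  obtain ⟨⟨y₀, z₀⟩, ⟨hy₀, hz₀⟩, hmax⟩ :=
    (hMc.prod hMc).exists_isMaxOn ⟨(y, y), hy, hy⟩ hpc.continuousOn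
  have hdiam : ∀ a ∈ M, ∀ b ∈ M, p ((a : E) - b) ≤ p ((y₀ : E) - z₀) :=
    fun a ha b hb => hmax (Set.mk_mem_prod ha hb)
  by_contra hne
  have hd : 0 < p ((y₀ : E) - z₀) :=
    ((apply_nonneg p _).lt_of_ne' hne).trans_le (hdiam y hy z hz)
  obtain ⟨u, hu, r, hr, hur⟩ := exists_center_lt_diam (hMc.image continuous_subtype_val)
    ⟨y, y, hy, rfl⟩ hp hd (by
      rintro _ ⟨a, ha, rfl⟩ _ ⟨b, hb, rfl⟩
      exact hdiam a ha b hb)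
  obtain ⟨hDc, -, hDJ⟩ := hD.prop
  have hclosed : IsClosed (⋂ y ∈ M, p.closedBall (y : E) r) :=
    isClosed_biInter fun y _ => isClosed_le (hp.comp (continuous_id.sub continuous_const))
      continuous_const
  have huD : u ∈ D ∩ ⋂ y ∈ M, p.closedBall (y : E) r :=
    ⟨convexHull_min hMD hDJ.convex hu, Set.mem_iInter₂.2 fun y hy => hur y ⟨y, hy, rfl⟩⟩
  have hsub := hD.le_of_le ⟨hDc.inter_right hclosed, ⟨u, huD⟩, hDJ.inter_closedBall hJ hM r⟩
    Set.inter_subset_left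
  exact hr.not_ge (Set.mem_iInter₂.1 (hsub (hMD ⟨y₀, hy₀, rfl⟩)).2 z₀ hz₀)

theorem exists_forall_apply_apply_eq [T2Space E] {Q : Set (Seminorm ℝ E)}
    (hQ : WithSeminorms (fun p : Q => (p : Seminorm ℝ E))) (hC : IsCompact C)
    (hconv : Convex ℝ C) (hCne : C.Nonempty) {Γ : Set (C → C)} (hΓ : IsCompact Γ)
    (hne : Γ.Nonempty) (hmul : ∀ f ∈ Γ, ∀ g ∈ Γ, f ∘ g ∈ Γ)
    (hexp : ∀ f ∈ Γ, Subtype.val ∘ f ∈ nonexpansiveMaps Q C) :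
    ∃ j ∈ Γ, ∃ y : C, ∀ γ ∈ Γ, j (γ y) = y := by
  have := hQ.topologicalAddGroup
  obtain ⟨J, hJΓ, hJc, ⟨j, hj⟩, hJ, hJJ⟩ := exists_isCompact_right_ideal hΓ hne hmul
    fun f hf => continuous_induced_rng.2 (continuous_of_mem_nonexpansiveMaps hQ (hexp f hf))
  obtain ⟨D, -, hD⟩ := exists_minimal_isCompact (P := IsInvariantConvex J)
    (fun _ => IsInvariantConvex.sInter) hC hCne ⟨subset_rfl, hconv, fun j _ x _ => (j x).2⟩
  obtain ⟨-, ⟨x, hx⟩, hDJ⟩ := hD.prop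
  lift x to C using hDJ.subset hx
  let M : Set C := (fun i : C → C => i x) '' J
  have hMc : IsCompact M := hJc.image (continuous_apply x)
  have hMD : Subtype.val '' M ⊆ D := by
    rintro _ ⟨_, ⟨i, hi, rfl⟩, rfl⟩
    exact hDJ.apply_mem i hi x hx
  have hMj : ∀ i ∈ J, M ⊆ i '' M := by
    rintro i hi _ ⟨k, hk, rfl⟩
    obtain ⟨k', hk', rfl⟩ := (hJJ i hi).superset hk
    exact ⟨k' x, ⟨k', hk', rfl⟩, rfl⟩
  have hsubsingleton : M.Subsingleton := by
    intro y hy z hz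
    by_contra hyz
    obtain ⟨p, hp⟩ := hQ.separating_of_T1 ((y : E) - z)
      (sub_ne_zero.2 (Subtype.coe_injective.ne hyz))
    exact hp (seminorm_sub_eq_zero_of_minimal hD (hQ.continuous_seminorm p)
      (fun i hi => hexp i (hJΓ hi) p p.2) hMc hMD hMj hy hz)
  refine ⟨j, hJΓ hj, j x, fun γ hγ => hsubsingleton ⟨j ∘ γ ∘ j, ?_, rfl⟩ ⟨j, hj, rfl⟩⟩
  exact hJ j hj _ (hmul γ hγ j (hJΓ hj))

end DeMarr

namespace MPlus

section Comb

variable {K : Type*} [TopologicalSpace K] [MeasurableSpace K] [BorelSpace K] [T2Space K]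

/-- The combination `a μ + b ν` of two elements of `M⁺(K)`. -/
def comb (a b : ℝ≥0) (μ ν : MPlus K) : MPlus K :=
  ⟨a • μ.meas + b • ν.meas, inferInstance, by
    have hreg (c : ℝ≥0) (ω : MPlus K) : (c • ω.meas).InnerRegular :=
      inferInstanceAs ((c : ℝ≥0∞) • ω.meas).InnerRegular
    have := hreg a μ
    have := hreg b ν
    have : (a • μ.meas + b • ν.meas).InnerRegular := inferInstance
    infer_instance⟩

theorem comb_meas (a b : ℝ≥0) (μ ν : MPlus K) :
    (comb a b μ ν).meas = a • μ.meas + b • ν.meas := rfl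

theorem real_comb (a b : ℝ≥0) (μ ν : MPlus K) (A : Set K) :
    (comb a b μ ν).meas.real A = a • μ.meas.real A + b • ν.meas.real A := by
  rw [comb_meas, measureReal_add_apply, measureReal_nnreal_smul_apply,
    measureReal_nnreal_smul_apply]
  rfl

theorem integral_comb {F : Type*} [NormedAddCommGroup F] [NormedSpace ℝ F] (a b : ℝ≥0)
    (μ ν : MPlus K) {f : K → F} (hμ : Integrable f μ.meas) (hν : Integrable f ν.meas) :
    ∫ x, f x ∂(comb a b μ ν).meas = a • ∫ x, f x ∂μ.meas + b • ∫ x, f x ∂ν.meas := by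
  rw [comb_meas, integral_add_measure hμ.smul_measure_nnreal hν.smul_measure_nnreal,
    integral_smul_nnreal_measure, integral_smul_nnreal_measure]

/-- `F` respects the convex combinations of measures. -/
def IsAffine {W : Type*} [AddCommMonoid W] [Module ℝ≥0 W] (F : MPlus K → W) : Prop :=
  ∀ (a b : ℝ≥0) (μ ν : MPlus K), a + b = 1 → F (comb a b μ ν) = a • F μ + b • F ν

theorem isAffine_const {W : Type*} [AddCommMonoid W] [Module ℝ≥0 W] (w : W) :
    IsAffine fun _ : MPlus K => w := fun a b _ _ hab => by rw [← add_smul, hab, one_smul]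

theorem isAffine_integral [OpensMeasurableSpace K] (f : K →ᵇ ℂ) :
    IsAffine fun μ : MPlus K => ∫ x, f x ∂μ.meas :=
  fun a b μ ν _ => integral_comb a b μ ν (f.integrable _) (f.integrable _)

theorem isAffine_real (A : Set K) : IsAffine fun μ : MPlus K => μ.meas.real A :=
  fun a b μ ν _ => real_comb a b μ ν A

end Comb

section Linear

variable {K : Type*} [TopologicalSpace K] [MeasurableSpace K] [BorelSpace K] [T2Space K]

theorem toM_apply (μ : MPlus K) {A : Set K} (hA : MeasurableSet A) :
    (μ.toM : ComplexMeasure K) A = (μ.meas.real A : ℂ) := by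
  change (μ.meas.toSignedMeasure.toComplexMeasure 0) A = _
  rw [SignedMeasure.toComplexMeasure_apply, Measure.toSignedMeasure_apply_measurable hA]
  rfl

theorem toM_injective : Function.Injective (toM : MPlus K → M K) := by
  refine fun μ ν h => Subtype.ext (Measure.ext fun A hA => ?_)
  have hreal := congrArg (fun c : M K => (c : ComplexMeasure K) A) h
  simp only [toM_apply _ hA, Complex.ofReal_inj] at hreal
  exact (measureReal_eq_measureReal_iff (measure_ne_top μ.meas _) (measure_ne_top ν.meas _)).1 hreal

theorem toM_comb (a b : ℝ≥0) (μ ν : MPlus K) :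
    (comb a b μ ν).toM = ((a : ℝ) : ℂ) • μ.toM + ((b : ℝ) : ℂ) • ν.toM := by
  refine Subtype.ext (VectorMeasure.ext fun A hA => ?_)
  change _ = ((a : ℝ) : ℂ) • (μ.toM : ComplexMeasure K) A
    + ((b : ℝ) : ℂ) • (ν.toM : ComplexMeasure K) A
  rw [toM_apply _ hA, toM_apply _ hA, toM_apply _ hA, real_comb]
  simp [NNReal.smul_def]

theorem map_comb_of_linear {T : MPlus K → MPlus K} {A : M K →ₗ[ℂ] M K}
    (hA : ∀ μ, (T μ).toM = A μ.toM) (a b : ℝ≥0) (μ ν : MPlus K) :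
    T (comb a b μ ν) = comb a b (T μ) (T ν) := by
  refine toM_injective ?_
  rw [hA, toM_comb, toM_comb, map_add, map_smul, map_smul, hA, hA]

theorem IsAffine.comp_linear {W : Type*} [AddCommMonoid W] [Module ℝ≥0 W] {F : MPlus K → W}
    (hF : IsAffine F) {T : MPlus K → MPlus K} {A : M K →ₗ[ℂ] M K}
    (hA : ∀ μ, (T μ).toM = A μ.toM) : IsAffine fun μ => F (T μ) := fun a b μ ν hab => by
  simp only [map_comb_of_linear hA, hF a b _ _ hab]

end Linear

section PointMasses

variable {K : Type*} [TopologicalSpace K] [MeasurableSpace K]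

variable (K) in
/-- The probability measures in `M⁺(K)`. -/
def probabilities : Set (MPlus K) := {μ | IsProbabilityMeasure μ.meas}

theorem mem_probabilities_iff {μ : MPlus K} :
    μ ∈ probabilities K ↔ μ.meas.real Set.univ = 1 := by
  rw [probabilities, Set.mem_ofPred_eq, isProbabilityMeasure_iff, measureReal_def,
    ENNReal.toReal_eq_one_iff]

/-- The coordinates of a measure that define the cone topology. -/
def coneCoord (μ : MPlus K) : (C_c(K, ℝ≥0) → ℝ) × ℝ :=
  (fun f => ∫ x, (f x : ℝ) ∂μ.meas, μ.meas.real Set.univ)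

theorem continuous_real_univ : Continuous fun μ : MPlus K => μ.meas.real Set.univ :=
  continuous_snd.comp (continuous_induced_dom (f := coneCoord))

variable [BorelSpace K]

theorem integrable_cc (f : C_c(K, ℝ≥0)) (μ : MPlus K) :
    Integrable (fun x => (f x : ℝ)) μ.meas :=
  (NNReal.continuous_coe.comp f.continuous).integrable_of_hasCompactSupport
    (f.hasCompactSupport.comp_left (g := fun r : ℝ≥0 => (r : ℝ)) rfl)

variable [T2Space K]

theorem coneCoord_comb (a b : ℝ≥0) (μ ν : MPlus K) :
    coneCoord (comb a b μ ν) = a • coneCoord μ + b • coneCoord ν :=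
  Prod.ext (funext fun f => integral_comb a b μ ν (integrable_cc f μ) (integrable_cc f ν))
    (real_comb a b μ ν Set.univ)

variable [LocallyCompactSpace K]

theorem continuousOn_integral_probabilities (f : K →ᵇ ℂ) :
    ContinuousOn (fun μ : MPlus K => ∫ x, f x ∂μ.meas) (probabilities K) :=
  continuousOn_iff_continuous_domRestrict.2 <|
    continuous_integral_complex (ρ := Subtype.val) continuous_subtype_val (fun μ => μ.2) f

theorem integral_point {F : Type*} [NormedAddCommGroup F] [NormedSpace ℝ F] [CompleteSpace F]
    (f : K → F) (x : K) :
    ∫ z, f z ∂(point x).meas = f x := integral_dirac f x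

theorem point_mem_probabilities (x : K) : point x ∈ probabilities K :=
  inferInstanceAs (IsProbabilityMeasure (Measure.dirac x))

theorem isWeakIntegral_coneCoord_point (μ : MPlus K) :
    IsWeakIntegral μ.meas (fun x => coneCoord (point x)) (coneCoord μ) := by
  have hmass (x : K) : (point x).meas.real Set.univ = 1 :=
    mem_probabilities_iff.1 (point_mem_probabilities x)
  simp only [coneCoord, integral_point, hmass]
  refine .prodMk (.pi fun f => isWeakIntegral_integral (integrable_cc f μ)) ?_
  simpa using isWeakIntegral_integral (integrable_const (μ := μ.meas) (1 : ℝ))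

theorem probabilities_subset_closure {P : Set (MPlus K)} (hpoint : ∀ x, point x ∈ P)
    (hcomb : ∀ μ ∈ P, ∀ ν ∈ P, ∀ a b : ℝ≥0, a + b = 1 → comb a b μ ν ∈ P) :
    probabilities K ⊆ closure P := by
  intro μ (hμ : IsProbabilityMeasure μ.meas)
  refine closure_induced.2 ?_
  change coneCoord μ ∈ closure (coneCoord '' P)
  refine closedConvexHull_min ?_ (Convex.closure ?_) isClosed_closure
    (isWeakIntegral_coneCoord_point μ).mem_closedConvexHull
  · rintro _ ⟨x, rfl⟩
    exact subset_closure ⟨_, hpoint x, rfl⟩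
  · rintro _ ⟨ν₁, h₁, rfl⟩ _ ⟨ν₂, h₂, rfl⟩ a b ha hb hab
    lift a to ℝ≥0 using ha
    lift b to ℝ≥0 using hb
    exact ⟨comb a b ν₁ ν₂, hcomb _ h₁ _ h₂ a b (by exact_mod_cast hab), coneCoord_comb a b ν₁ ν₂⟩

theorem IsAffine.eqOn_probabilities {W : Type*} [AddCommMonoid W] [Module ℝ≥0 W]
    [TopologicalSpace W] [T2Space W] {F G : MPlus K → W} (hF : IsAffine F) (hG : IsAffine G)
    (hFc : ContinuousOn F (probabilities K)) (hGc : ContinuousOn G (probabilities K))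
    (h : ∀ x, F (point x) = G (point x)) : Set.EqOn F G (probabilities K) := by
  have heq : Set.EqOn F G {μ ∈ probabilities K | F μ = G μ} := fun μ hμ => hμ.2
  refine heq.of_subset_closure hFc hGc (Set.sep_subset _ _)
    (probabilities_subset_closure (fun x => ⟨point_mem_probabilities x, h x⟩) ?_)
  rintro μ ⟨hμ, hμ'⟩ ν ⟨hν, hν'⟩ a b hab
  refine ⟨mem_probabilities_iff.2 ?_, by rw [hF a b μ ν hab, hG a b μ ν hab, hμ', hν']⟩
  rw [real_comb, mem_probabilities_iff.1 hμ, mem_probabilities_iff.1 hν, ← add_smul, hab, one_smul]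

variable {T : MPlus K → MPlus K} {A : M K →ₗ[ℂ] M K}

theorem map_mem_probabilities (hT : Continuous T) (hA : ∀ μ, (T μ).toM = A μ.toM)
    (hp : ∀ x, T (point x) ∈ probabilities K) {μ : MPlus K} (hμ : μ ∈ probabilities K) :
    T μ ∈ probabilities K :=
  mem_probabilities_iff.2 <|
    ((isAffine_real Set.univ).comp_linear hA).eqOn_probabilities (isAffine_const 1)
      (continuous_real_univ.comp hT).continuousOn continuousOn_const
      (fun x => mem_probabilities_iff.1 (hp x)) hμ

theorem integral_map (hT : Continuous T) (hA : ∀ μ, (T μ).toM = A μ.toM)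
    (hp : ∀ x, T (point x) ∈ probabilities K) (f : K →ᵇ ℂ) {μ : MPlus K}
    (hμ : μ ∈ probabilities K) :
    ∫ x, f x ∂(T μ).meas = ∫ y, ∫ x, f x ∂(T (point y)).meas ∂μ.meas := by
  have hbound (y : K) : ‖∫ x, f x ∂(T (point y)).meas‖ ≤ ‖f‖ := by
    have : IsProbabilityMeasure (T (point y)).meas := hp y
    simpa using norm_integral_le_of_norm_le_const (μ := (T (point y)).meas)
      (.of_forall f.norm_coe_le_norm)
  let g : K →ᵇ ℂ := .ofNormedAddCommGroup (fun y => ∫ x, f x ∂(T (point y)).meas)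
    (continuous_integral_complex (hT.comp continuous_point) hp f) ‖f‖ hbound
  exact ((isAffine_integral f).comp_linear hA).eqOn_probabilities (isAffine_integral g)
    ((continuousOn_integral_probabilities f).comp hT.continuousOn
      fun ν hν => map_mem_probabilities hT hA hp hν)
    (continuousOn_integral_probabilities g) (fun x => (integral_point g x).symm) hμ

end PointMasses

end MPlus

namespace SemitopologicalSemihypergroup

variable {K : Type*} [TopologicalSpace K] [MeasurableSpace K] [BorelSpace K] [T2Space K]
  [LocallyCompactSpace K] (S : SemitopologicalSemihypergroup K)

section LeftTranslate

theorem integral_convPlus_point_left (x : K) (f : K →ᵇ ℂ) {μ : MPlus K}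
    (hμ : μ ∈ MPlus.probabilities K) :
    ∫ z, f z ∂(S.convPlus (MPlus.point x) μ).meas = ∫ y, ∫ z, f z ∂(S.pconv x y) ∂μ.meas :=
  MPlus.integral_map (A := S.conv (MPlus.point x).toM) (S.continuous_convPlus_left _)
    (S.toM_convPlus _) (S.isProbabilityMeasure_point x) f hμ

theorem integral_convPlus_point_right (y : K) (f : K →ᵇ ℂ) {μ : MPlus K}
    (hμ : μ ∈ MPlus.probabilities K) :
    ∫ z, f z ∂(S.convPlus μ (MPlus.point y)).meas = ∫ x, ∫ z, f z ∂(S.pconv x y) ∂μ.meas :=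
  MPlus.integral_map (A := S.conv.flip (MPlus.point y).toM) (S.continuous_convPlus_right _)
    (fun μ => S.toM_convPlus μ _) (fun x => S.isProbabilityMeasure_point x y) f hμ

theorem convPlus_assoc (μ ν ω : MPlus K) :
    S.convPlus (S.convPlus μ ν) ω = S.convPlus μ (S.convPlus ν ω) :=
  MPlus.toM_injective (by simp only [S.toM_convPlus, S.conv_assoc])

theorem leftTranslate_leftTranslate_apply (x y z : K) (f : K →ᵇ ℂ) :
    S.leftTranslate x (S.leftTranslate y f) z
      = ∫ ζ, S.leftTranslate ζ f z ∂(S.pconv y x) :=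
  calc S.leftTranslate x (S.leftTranslate y f) z
    _ = ∫ ζ, f ζ ∂(S.convPlus (.point y) (S.convPlus (.point x) (.point z))).meas :=
        (S.integral_convPlus_point_left y f (S.isProbabilityMeasure_point x z)).symm
    _ = ∫ ζ, f ζ ∂(S.convPlus (S.convPlus (.point y) (.point x)) (.point z)).meas := by
        rw [S.convPlus_assoc]
    _ = _ := S.integral_convPlus_point_right z f (S.isProbabilityMeasure_point y x)

theorem leftTranslate_identity {e : K} (he : S.IsIdentity e) (f : K →ᵇ ℂ) :
    S.leftTranslate e f = f := by
  ext y
  rw [leftTranslate_apply, (he y).2, integral_dirac]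

theorem norm_leftTranslate_le (x : K) (f : K →ᵇ ℂ) : ‖S.leftTranslate x f‖ ≤ ‖f‖ :=
  (norm_le (norm_nonneg f)).2 fun y => by
    simpa [leftTranslate_apply] using norm_integral_le_of_norm_le_const (μ := S.pconv x y)
      (.of_forall f.norm_coe_le_norm)

theorem continuous_leftTranslate_apply (f : K →ᵇ ℂ) (y : K) :
    Continuous fun x => S.leftTranslate x f y :=
  continuous_integral_complex ((S.continuous_convPlus_right (MPlus.point y)).comp
    MPlus.continuous_point) (fun x => S.isProbabilityMeasure_point x y) f

end LeftTranslate

section AlmostPeriodic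

variable {S} {f : K →ᵇ ℂ}

theorem leftTranslate_mem_closure (x : K) :
    S.leftTranslate x f ∈ closure (Set.range fun x => S.leftTranslate x f) :=
  subset_closure ⟨x, rfl⟩

theorem continuous_leftTranslate (hf : f ∈ S.AP) : Continuous fun x => S.leftTranslate x f := by
  set X := closure (Set.range fun x => S.leftTranslate x f)
  have : CompactSpace X := isCompact_iff_compactSpace.1 hf
  -- On the compact set `X` the norm topology is the topology of pointwise convergence.
  have hemb : IsClosedEmbedding fun (g : X) (y : K) => (g : K →ᵇ ℂ) y :=
    Continuous.isClosedEmbedding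
      (continuous_pi fun y => (continuous_eval_const y).comp continuous_subtype_val)
      fun g h hgh => Subtype.ext (DFunLike.coe_injective hgh)
  have hX : Continuous fun x => (⟨S.leftTranslate x f, leftTranslate_mem_closure x⟩ : X) :=
    hemb.isInducing.continuous_iff.2 (continuous_pi fun y => S.continuous_leftTranslate_apply f y)
  exact continuous_subtype_val.comp hX

theorem integrable_leftTranslate (hf : f ∈ S.AP) (μ : Measure K) [IsFiniteMeasure μ] :
    Integrable (fun x => S.leftTranslate x f) μ :=
  integrable_of_continuous_of_forall_mem μ (continuous_leftTranslate hf) hf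
    leftTranslate_mem_closure

theorem leftTranslate_leftTranslate (hf : f ∈ S.AP) (x y : K) :
    S.leftTranslate x (S.leftTranslate y f) = ∫ ζ, S.leftTranslate ζ f ∂(S.pconv y x) := by
  ext z
  rw [S.leftTranslate_leftTranslate_apply]
  exact (evalCLM ℂ z).integral_comp_comm (integrable_leftTranslate hf (S.pconv y x))

theorem isCompact_closedConvexHull_leftTranslate (hf : f ∈ S.AP) :
    IsCompact (closedConvexHull ℝ (Set.range fun x => S.leftTranslate x f)) := by
  rw [closedConvexHull_eq_closure_convexHull]
  exact (hf.totallyBounded.subset subset_closure).convexHull.closure.isCompact_of_isClosed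
    isClosed_closure

theorem leftTranslate_mem_closedConvexHull (hf : f ∈ S.AP) (x : K) {g : K →ᵇ ℂ}
    (hg : g ∈ closedConvexHull ℝ (Set.range fun x => S.leftTranslate x f)) :
    S.leftTranslate x g ∈ closedConvexHull ℝ (Set.range fun x => S.leftTranslate x f) := by
  let T : (K →ᵇ ℂ) →L[ℂ] (K →ᵇ ℂ) := (S.leftTranslate x).mkContinuous 1 fun h =>
    (S.norm_leftTranslate_le x h).trans_eq (one_mul _).symm
  refine mapsTo_closedConvexHull (T.restrictScalars ℝ) ?_ hg
  rintro _ ⟨y, rfl⟩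
  have hT : T (S.leftTranslate y f) = ∫ ζ, S.leftTranslate ζ f ∂(S.pconv y x) :=
    leftTranslate_leftTranslate hf x y
  rw [ContinuousLinearMap.coe_restrictScalars', hT]
  exact convex_closedConvexHull.integral_mem isClosed_closedConvexHull
    (.of_forall fun ζ => subset_closedConvexHull ⟨ζ, rfl⟩)
    (integrable_leftTranslate hf (S.pconv y x))

theorem mem_AP_of_mem_closedConvexHull (hf : f ∈ S.AP) {g : K →ᵇ ℂ}
    (hg : g ∈ closedConvexHull ℝ (Set.range fun x => S.leftTranslate x f)) : g ∈ S.AP :=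
  (isCompact_closedConvexHull_leftTranslate hf).closure_of_subset <|
    Set.range_subset_iff.2 fun x => leftTranslate_mem_closedConvexHull hf x hg

theorem leftTranslate_mem_AP (hf : f ∈ S.AP) (y : K) : S.leftTranslate y f ∈ S.AP :=
  mem_AP_of_mem_closedConvexHull hf (subset_closedConvexHull ⟨y, rfl⟩)

end AlmostPeriodic

section APTranslate

/-- Left translation as an operator on `AP(K)`. -/
def apTranslate (x : K) : S.AP →L[ℂ] S.AP :=
  LinearMap.mkContinuous ((S.leftTranslate x).restrict fun _ hf => leftTranslate_mem_AP hf x) 1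
    fun f => (S.norm_leftTranslate_le x f).trans_eq (one_mul _).symm

theorem coe_apTranslate (x : K) (f : S.AP) :
    (S.apTranslate x f : K →ᵇ ℂ) = S.leftTranslate x f := rfl

theorem norm_apTranslate_le (x : K) (f : S.AP) : ‖S.apTranslate x f‖ ≤ ‖f‖ :=
  S.norm_leftTranslate_le x f

theorem apTranslate_one (x : K) :
    S.apTranslate x ⟨1, S.one_mem_AP⟩ = ⟨1, S.one_mem_AP⟩ :=
  Subtype.ext (S.leftTranslate_one x)

theorem continuous_apTranslate (f : S.AP) : Continuous fun x => S.apTranslate x f :=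
  continuous_induced_rng.2 (continuous_leftTranslate f.2)

theorem apply_apTranslate_apTranslate (φ : S.AP →L[ℂ] ℂ) (s t : K) (f : S.AP) :
    φ (S.apTranslate t (S.apTranslate s f)) = ∫ z, φ (S.apTranslate z f) ∂(S.pconv s t) := by
  obtain ⟨φ', hφ', -⟩ := exists_extension_norm_eq S.AP φ
  simp only [← hφ', coe_apTranslate]
  rw [leftTranslate_leftTranslate f.2]
  exact (φ'.integral_comp_comm (integrable_leftTranslate f.2 (S.pconv s t))).symm

end APTranslate

end SemitopologicalSemihypergroup

section DualComp

variable {E : Type*} [AddCommGroup E] [Module ℝ E] [TopologicalSpace E] {Q : Set (Seminorm ℝ E)}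
  {C : Set E}

/-- The composition of a continuous linear functional with a non-expansive map. -/
def dualComp (hQ : WithSeminorms (fun p : Q => (p : Seminorm ℝ E))) (l : E →L[ℝ] ℝ)
    (γ : nonexpansiveMaps Q C) : C(C, ℝ) :=
  ⟨fun c => l (γ.1 c), l.continuous.comp (continuous_of_mem_nonexpansiveMaps hQ γ.2)⟩

theorem continuous_dualComp [CompactSpace C]
    (hQ : WithSeminorms (fun p : Q => (p : Seminorm ℝ E))) (l : E →L[ℝ] ℝ) :
    Continuous (dualComp (C := C) hQ l) :=
  continuous_continuousMap_of_equicontinuous (equicontinuous_apply_nonexpansiveMaps hQ l) fun c =>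
    l.continuous.comp ((continuous_apply c).comp continuous_subtype_val)

end DualComp

namespace SemitopologicalSemihypergroup.SepContAction

variable {K : Type*} [TopologicalSpace K] [MeasurableSpace K] [BorelSpace K] [T2Space K]
  [LocallyCompactSpace K] {S : SemitopologicalSemihypergroup K}
  {E : Type*} [AddCommGroup E] [Module ℝ E] [TopologicalSpace E] {Q : Set (Seminorm ℝ E)}
  {C : Set E} (π : S.SepContAction C)

theorem act_mem_nonexpansiveMaps (hπ : π.IsNonexpansive Q) (t : K) :
    (fun c => (π.act t c : E)) ∈ nonexpansiveMaps Q C :=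
  fun p hp => hπ p hp t

theorem isWeakIntegral_act (hC : IsCompact C) (s t : K) (c : C) :
    IsWeakIntegral (S.pconv s t) (fun z => (π.act z c : E)) (π.act s (π.act t c)) :=
  fun l => ⟨integrable_of_continuous_of_forall_mem _
    (l.continuous.comp (continuous_subtype_val.comp (π.continuous_orbit c)))
    (hC.image l.continuous) fun z => ⟨_, (π.act z c).2, rfl⟩, π.act_act s t c l⟩

section Hull

/-- The pointwise closed convex hull of the maps `π(s, ·)`, viewed as maps from `C` to `E`. -/
def hull : Set (C → E) := closedConvexHull ℝ (Set.range fun s c => (π.act s c : E))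

theorem act_mem_hull (s : K) : (fun c => (π.act s c : E)) ∈ π.hull :=
  subset_closedConvexHull ⟨s, rfl⟩

theorem hull_subset_nonexpansiveMaps (hQ : WithSeminorms (fun p : Q => (p : Seminorm ℝ E)))
    (hπ : π.IsNonexpansive Q) : π.hull ⊆ nonexpansiveMaps Q C :=
  closedConvexHull_min (Set.range_subset_iff.2 (π.act_mem_nonexpansiveMaps hπ))
    convex_nonexpansiveMaps (isClosed_nonexpansiveMaps hQ)

variable [IsTopologicalAddGroup E] [ContinuousSMul ℝ E] [LocallyConvexSpace ℝ E]

theorem comp_act_mem_hull (hC : IsCompact C) {δ : C → E} (hδ : δ ∈ π.hull) (t : K) :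
    δ ∘ π.act t ∈ π.hull := by
  let R : (C → E) →ₗ[ℝ] (C → E) := .funLeft ℝ E (π.act t)
  have hR : Continuous R := continuous_pi fun c => continuous_apply (π.act t c)
  have hmin : π.hull ⊆ R ⁻¹' π.hull := by
    refine closedConvexHull_min (Set.range_subset_iff.2 fun s => ?_)
      (convex_closedConvexHull.linear_preimage R) (isClosed_closedConvexHull.preimage hR)
    exact (IsWeakIntegral.pi (π.isWeakIntegral_act hC s t)).mem_closedConvexHull
  exact hmin hδ

end Hull

section OrbitMean

variable [CompactSpace C]

/-- The pullback of functions on `C` along the orbit map `s ↦ π(s, x)`. -/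
def orbitPullback (x : C) : C(C, ℝ) →L[ℝ] (K →ᵇ ℂ) :=
  LinearMap.mkContinuous
    { toFun h := (mkOfCompact ((Complex.ofRealCLM : C(ℝ, ℂ)).comp h)).compContinuous
        ⟨_, π.continuous_orbit x⟩
      map_add' h k := by ext; simp
      map_smul' r h := by ext; simp } 1
    fun h => by
      rw [one_mul]
      refine (norm_le (norm_nonneg h)).2 fun s => ?_
      simpa using h.norm_coe_le_norm (π.act s x)

theorem orbitPullback_apply (x : C) (h : C(C, ℝ)) (s : K) :
    π.orbitPullback x h s = (h (π.act s x) : ℂ) := rfl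

variable (hQ : WithSeminorms (fun p : Q => (p : Seminorm ℝ E)))

theorem leftTranslate_orbitPullback (hπ : π.IsNonexpansive Q) (x : C) (l : E →L[ℝ] ℝ) (t : K) :
    S.leftTranslate t (π.orbitPullback x (dualComp hQ l ⟨_, subtypeVal_mem_nonexpansiveMaps⟩)) =
      π.orbitPullback x (dualComp hQ l ⟨_, π.act_mem_nonexpansiveMaps hπ t⟩) := by
  ext s
  calc ∫ z, ((l (π.act z x) : ℝ) : ℂ) ∂(S.pconv t s)
    _ = ((∫ z, l (π.act z x) ∂(S.pconv t s) : ℝ) : ℂ) := integral_ofReal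
    _ = ((l (π.act t (π.act s x)) : ℝ) : ℂ) := congrArg Complex.ofReal (π.act_act t s x l).symm

theorem orbitPullback_mem_AP (hπ : π.IsNonexpansive Q) (x : C) (l : E →L[ℝ] ℝ) :
    π.orbitPullback x (dualComp hQ l ⟨_, subtypeVal_mem_nonexpansiveMaps⟩) ∈ S.AP := by
  have hcompact : IsCompact (Subtype.val ⁻¹' Set.univ.pi fun _ => C : Set (nonexpansiveMaps Q C)) :=
    (isClosed_nonexpansiveMaps hQ).isClosedEmbedding_subtypeVal.isCompact_preimage
      (isCompact_univ_pi fun _ => isCompact_iff_compactSpace.2 ‹_›)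
  refine (hcompact.image ((π.orbitPullback x).continuous.comp
    (continuous_dualComp hQ l))).closure_of_subset (Set.range_subset_iff.2 fun t => ?_)
  exact ⟨⟨_, π.act_mem_nonexpansiveMaps hπ t⟩, fun c _ => (π.act t c).2,
    (π.leftTranslate_orbitPullback hQ hπ x l t).symm⟩

theorem exists_orbitMean (hπ : π.IsNonexpansive Q) (x : C) (hS : S.IsLeftAmenableAP) :
    ∃ M : C(C, ℝ) →L[ℝ] ℂ, (∀ h (r : ℝ), (∀ s, h (π.act s x) = r) → M h = r) ∧
      ∀ l t, M (dualComp hQ l ⟨_, π.act_mem_nonexpansiveMaps hπ t⟩) =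
        M (dualComp hQ l ⟨_, subtypeVal_mem_nonexpansiveMaps⟩) := by
  obtain ⟨m, hm⟩ := hS
  obtain ⟨m', hm', -⟩ := exists_extension_norm_eq S.AP m
  refine ⟨(m'.restrictScalars ℝ).comp (π.orbitPullback x), fun h r hr => ?_, fun l t => ?_⟩
  · have hconst : π.orbitPullback x h = (r : ℂ) • 1 := by
      ext s
      simp [orbitPullback_apply, hr s]
    have hone : m' 1 = 1 := (hm' ⟨1, S.one_mem_AP⟩).trans hm.map_one
    simp [hconst, hone]
  · have hAP := π.orbitPullback_mem_AP hQ hπ x l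
    have hinv := hm.map_leftTranslate t ⟨_, hAP⟩ ⟨_, leftTranslate_mem_AP hAP t⟩ rfl
    rw [← hm', ← hm'] at hinv
    exact (congrArg m' (π.leftTranslate_orbitPullback hQ hπ x l t)).symm.trans hinv

theorem orbitMean_eq_of_mem_hull (hπ : π.IsNonexpansive Q) (l : E →L[ℝ] ℝ) {M : C(C, ℝ) →L[ℝ] ℂ}
    (hM : ∀ t, M (dualComp hQ l ⟨_, π.act_mem_nonexpansiveMaps hπ t⟩) =
      M (dualComp hQ l ⟨_, subtypeVal_mem_nonexpansiveMaps⟩)) {γ : C → E} (hγ : γ ∈ π.hull) :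
    M (dualComp hQ l ⟨γ, π.hull_subset_nonexpansiveMaps hQ hπ hγ⟩) =
      M (dualComp hQ l ⟨_, subtypeVal_mem_nonexpansiveMaps⟩) := by
  have hsub := π.hull_subset_nonexpansiveMaps hQ hπ
  refine eq_of_mem_closedConvexHull (F := fun δ => M (dualComp hQ l ⟨δ, hsub δ.2⟩))
    (M.continuous.comp ((continuous_dualComp hQ l).comp (continuous_inclusion hsub)))
    (fun a b δ₁ δ₂ δ _ _ _ hδ => ?_) (by rintro _ ⟨t, rfl⟩; exact hM t) ⟨γ, hγ⟩
  rw [← map_smul, ← map_smul, ← map_add]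
  refine congrArg M (ContinuousMap.ext fun c => ?_)
  simp [dualComp, hδ]

end OrbitMean

section FixedPoint

/-- The self-maps of `C` which lie in the hull and whose right action preserves the hull. -/
def hullSemigroup : Set (C → C) :=
  {γ | Subtype.val ∘ γ ∈ π.hull ∧ ∀ δ ∈ π.hull, δ ∘ γ ∈ π.hull}

theorem comp_mem_hullSemigroup {γ δ : C → C} (hγ : γ ∈ π.hullSemigroup)
    (hδ : δ ∈ π.hullSemigroup) : γ ∘ δ ∈ π.hullSemigroup :=
  ⟨hδ.2 _ hγ.1, fun η hη => hδ.2 _ (hγ.2 η hη)⟩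

theorem isClosed_hullSemigroup (hQ : WithSeminorms (fun p : Q => (p : Seminorm ℝ E)))
    (hπ : π.IsNonexpansive Q) : IsClosed π.hullSemigroup := by
  have hcomp {δ : C → E} (hδ : Continuous δ) : IsClosed {γ : C → C | δ ∘ γ ∈ π.hull} :=
    isClosed_closedConvexHull.preimage
      (continuous_pi fun c => hδ.comp (continuous_apply c))
  simp only [hullSemigroup, Set.ofPred_and, Set.ofPred_forall]
  exact (hcomp continuous_subtype_val).inter <| isClosed_biInter fun δ hδ =>
    hcomp (continuous_of_mem_nonexpansiveMaps hQ (π.hull_subset_nonexpansiveMaps hQ hπ hδ))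

theorem act_mem_hullSemigroup [IsTopologicalAddGroup E] [ContinuousSMul ℝ E]
    [LocallyConvexSpace ℝ E] (hC : IsCompact C) (t : K) : π.act t ∈ π.hullSemigroup :=
  ⟨π.act_mem_hull t, fun _ hδ => π.comp_act_mem_hull hC hδ t⟩

theorem exists_isCommonFixedPoint [Nonempty K] [IsTopologicalAddGroup E] [ContinuousSMul ℝ E]
    [T2Space E] (hS : S.IsLeftAmenableAP) (hQ : WithSeminorms (fun p : Q => (p : Seminorm ℝ E)))
    (hC : IsCompact C) (hconv : Convex ℝ C) (hne : C.Nonempty) (hπ : π.IsNonexpansive Q) :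
    ∃ x : C, π.IsCommonFixedPoint x := by
  have : CompactSpace C := isCompact_iff_compactSpace.1 hC
  have : LocallyConvexSpace ℝ E := hQ.toLocallyConvexSpace
  have hact := π.act_mem_hullSemigroup hC
  obtain ⟨j, hj, y, hy⟩ := exists_forall_apply_apply_eq hQ hC hconv hne
    (π.isClosed_hullSemigroup hQ hπ).isCompact ⟨_, hact (Classical.arbitrary K)⟩
    (fun _ hγ _ hδ => π.comp_mem_hullSemigroup hγ hδ)
    fun γ hγ => π.hull_subset_nonexpansiveMaps hQ hπ hγ.1
  obtain ⟨M, hMy, hM⟩ := π.exists_orbitMean hQ hπ y hS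
  -- `j` and `π(t, ·) ∘ j` are constant on the orbit of `y`, and `M` does not tell them apart.
  have hMconst (l : E →L[ℝ] ℝ) {γ : C → C} (hγ : γ ∈ π.hullSemigroup) {z : C}
      (hz : ∀ s, γ (π.act s y) = z) :
      M (dualComp hQ l ⟨_, subtypeVal_mem_nonexpansiveMaps⟩) = (l z : ℝ) := by
    rw [← π.orbitMean_eq_of_mem_hull hQ hπ l (hM l) hγ.1]
    exact hMy _ _ fun s => congrArg (fun c : C => l c) (hz s)
  refine ⟨y, fun t => Subtype.ext <| (SeparatingDual.eq_iff_forall_dual_eq (R := ℝ)).2 fun l => ?_⟩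
  have hj_eq := hMconst l hj fun s => hy _ (hact s)
  have htj_eq := hMconst l (π.comp_mem_hullSemigroup (hact t) hj) fun s =>
    congrArg (π.act t) (hy _ (hact s))
  exact_mod_cast htj_eq.symm.trans hj_eq

end FixedPoint

end SemitopologicalSemihypergroup.SepContAction

namespace SemitopologicalSemihypergroup

variable {K : Type u} [TopologicalSpace K] [MeasurableSpace K] [BorelSpace K] [T2Space K]
  [LocallyCompactSpace K] (S : SemitopologicalSemihypergroup K)

section Means

/-- The means on `AP(K)`: the functionals `φ` with `‖φ‖ ≤ 1` and `φ 1 = 1`, with the weak-*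
topology. -/
def means : Set (WeakDual ℂ S.AP) :=
  {φ | (∀ f, ‖φ f‖ ≤ ‖f‖) ∧ φ ⟨1, S.one_mem_AP⟩ = 1}

theorem isCompact_means : IsCompact S.means := by
  refine (WeakDual.isCompact_closedBall (0 : StrongDual ℂ S.AP) 1).of_isClosed_subset ?_
    fun φ hφ => mem_closedBall_zero_iff.2 <|
      (WeakDual.toStrongDual φ).opNorm_le_bound zero_le_one fun f =>
        (hφ.1 f).trans_eq (one_mul _).symm
  simp only [means, Set.ofPred_and, Set.ofPred_forall]
  exact (isClosed_iInter fun f => isClosed_le (WeakDual.eval_continuous f).norm continuous_const)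
    |>.inter (isClosed_eq (WeakDual.eval_continuous _) continuous_const)

theorem convex_means : Convex ℝ S.means := by
  intro φ hφ ψ hψ a b ha hb hab
  refine ⟨fun f => ?_, ?_⟩
  · exact mem_closedBall_zero_iff.1 <| convex_closedBall (0 : ℂ) ‖f‖
      (mem_closedBall_zero_iff.2 (hφ.1 f)) (mem_closedBall_zero_iff.2 (hψ.1 f)) ha hb hab
  · change a • φ _ + b • ψ _ = 1
    rw [hφ.2, hψ.2, ← add_smul, hab, one_smul]

theorem means_nonempty [Nonempty K] : S.means.Nonempty :=
  have k := Classical.arbitrary K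
  ⟨StrongDual.toWeakDual ((evalCLM ℂ k).comp S.AP.subtypeL),
    fun f => (f : K →ᵇ ℂ).norm_coe_le_norm k, rfl⟩

/-- The adjoint `φ ↦ φ ∘ L_s` of a left translation. -/
def dualTranslate (s : K) (φ : WeakDual ℂ S.AP) : WeakDual ℂ S.AP :=
  StrongDual.toWeakDual ((WeakDual.toStrongDual φ).comp (S.apTranslate s))

theorem dualTranslate_apply (s : K) (φ : WeakDual ℂ S.AP) (f : S.AP) :
    S.dualTranslate s φ f = φ (S.apTranslate s f) := rfl

theorem continuous_dualTranslate (φ : WeakDual ℂ S.AP) :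
    Continuous fun s => S.dualTranslate s φ :=
  WeakDual.continuous_of_continuous_eval fun f =>
    (WeakDual.toStrongDual φ).continuous.comp (S.continuous_apTranslate f)

variable {S} in
theorem dualTranslate_mem_means {φ : WeakDual ℂ S.AP} (hφ : φ ∈ S.means) (s : K) :
    S.dualTranslate s φ ∈ S.means :=
  ⟨fun f => (hφ.1 _).trans (S.norm_apTranslate_le s f), by
    rw [dualTranslate_apply, apTranslate_one, hφ.2]⟩

end Means

section OrbitCoordinates

/-- The function `x ↦ φ (L_x f)`. -/
def orbit (φ : WeakDual ℂ S.AP) (f : S.AP) : K →ᵇ ℂ :=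
  .ofNormedAddCommGroup (fun x => φ (S.apTranslate x f))
    ((WeakDual.toStrongDual φ).continuous.comp (S.continuous_apTranslate f))
    (‖WeakDual.toStrongDual φ‖ * ‖f‖) fun x =>
      (WeakDual.toStrongDual φ).le_opNorm_of_le (S.norm_apTranslate_le x f)

theorem continuousOn_orbit (f : S.AP) : ContinuousOn (fun φ => S.orbit φ f) S.means := by
  let H : Set (K →ᵇ ℂ) := closedConvexHull ℝ (Set.range fun x => S.leftTranslate x f)
  have : CompactSpace H :=
    isCompact_iff_compactSpace.1 (isCompact_closedConvexHull_leftTranslate f.2)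
  let toAP (g : H) : S.AP := ⟨g, mem_AP_of_mem_closedConvexHull f.2 g.2⟩
  have htoAP : Continuous toAP := continuous_induced_rng.2 continuous_subtype_val
  let restrict (φ : S.means) : C(H, ℂ) :=
    ⟨fun g => φ.1 (toAP g), (WeakDual.toStrongDual φ.1).continuous.comp htoAP⟩
  have hequi : Equicontinuous fun φ g => restrict φ g :=
    Metric.equicontinuous_of_continuity_modulus id Filter.tendsto_id _ fun g h φ => by
      rw [dist_eq_norm]
      exact (congrArg norm (map_sub φ.1 (toAP g) (toAP h))).symm.trans_le
        ((φ.2.1 _).trans_eq (dist_eq_norm (g : K →ᵇ ℂ) h).symm)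
  have hrestrict : Continuous restrict :=
    continuous_continuousMap_of_equicontinuous hequi fun g =>
      (WeakDual.eval_continuous (toAP g)).comp continuous_subtype_val
  let orbitMap : C(K, H) := ⟨fun x => ⟨S.leftTranslate x f, subset_closedConvexHull ⟨x, rfl⟩⟩,
    continuous_induced_rng.2 (continuous_leftTranslate f.2)⟩
  exact continuousOn_iff_continuous_domRestrict.2 <|
    (continuous_compContinuous orbitMap).comp
      ((ContinuousMap.linearIsometryBoundedOfCompact H ℂ ℂ).continuous.comp hrestrict)

/-- The dual of `AP(K)`, mapped into a product of normed spaces by recording the values of a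
functional on the orbits of all almost periodic functions, so that the orbits converge uniformly.
The index type is lifted to the universe of the test spaces. -/
def dualEmbedding (φ : WeakDual ℂ S.AP) : ULift.{v} S.AP → ℂ × (K →ᵇ ℂ) :=
  fun f => (φ f.down, S.orbit φ f.down)

theorem continuousOn_dualEmbedding : ContinuousOn (dualEmbedding.{u, v} S) S.means :=
  continuousOn_pi.2 fun f =>
    (WeakDual.eval_continuous f.down).continuousOn.prodMk (S.continuousOn_orbit f.down)

theorem isCompact_image_means : IsCompact (dualEmbedding.{u, v} S '' S.means) :=
  S.isCompact_means.image_of_continuousOn S.continuousOn_dualEmbedding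

theorem convex_image_means : Convex ℝ (dualEmbedding.{u, v} S '' S.means) := by
  rintro _ ⟨φ, hφ, rfl⟩ _ ⟨ψ, hψ, rfl⟩ a b ha hb hab
  exact ⟨a • φ + b • ψ, S.convex_means hφ hψ ha hb hab,
    funext fun f => Prod.ext rfl (BoundedContinuousFunction.ext fun x => rfl)⟩

/-- The right translation `R_y g x = ∫ g d(p_x * p_y)` on bounded continuous functions. -/
def rightTranslate (y : K) : (K →ᵇ ℂ) →L[ℂ] (K →ᵇ ℂ) :=
  LinearMap.mkContinuous
    { toFun g := .ofNormedAddCommGroup (fun x => S.leftTranslate x g y)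
        (S.continuous_leftTranslate_apply g y) ‖g‖ fun x =>
          (norm_coe_le_norm _ y).trans (S.norm_leftTranslate_le x g)
      map_add' g h := by ext; simp
      map_smul' c g := by ext; simp } 1
    fun g => by
      rw [one_mul]
      exact (norm_le (norm_nonneg g)).2 fun x =>
        (norm_coe_le_norm _ y).trans (S.norm_leftTranslate_le x g)

/-- The operator `(a, g) ↦ (g s, R_s g)`, which extends `φ ↦ φ ∘ L_s` on each coordinate. -/
def coordTranslate (s : K) : ℂ × (K →ᵇ ℂ) →L[ℂ] ℂ × (K →ᵇ ℂ) :=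
  ((evalCLM ℂ s).prod (S.rightTranslate s)).comp (.snd ℂ ℂ (K →ᵇ ℂ))

theorem norm_coordTranslate_le (s : K) (v : ℂ × (K →ᵇ ℂ)) : ‖S.coordTranslate s v‖ ≤ ‖v‖ := by
  refine (max_le (v.2.norm_coe_le_norm s) ?_).trans (le_max_right ‖v.1‖ ‖v.2‖)
  exact (norm_le (norm_nonneg _)).2 fun x =>
    (norm_coe_le_norm _ s).trans (S.norm_leftTranslate_le x v.2)

theorem coordTranslate_dualEmbedding (s : K) (φ : WeakDual ℂ S.AP) (f : ULift.{v} S.AP) :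
    S.coordTranslate s (dualEmbedding S φ f) = dualEmbedding S (S.dualTranslate s φ) f :=
  Prod.ext rfl <| BoundedContinuousFunction.ext fun x =>
    (S.apply_apTranslate_apTranslate (WeakDual.toStrongDual φ) x s f.down).symm

end OrbitCoordinates

section MeanAction

variable {S} in
theorem continuous_dualEmbedding_dualTranslate {φ : WeakDual ℂ S.AP} (hφ : φ ∈ S.means) :
    Continuous fun z => dualEmbedding.{u, v} S (S.dualTranslate z φ) :=
  S.continuousOn_dualEmbedding.comp_continuous (S.continuous_dualTranslate φ)
    (dualTranslate_mem_means hφ)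

variable {S} in
theorem isWeakIntegral_dualEmbedding {φ : WeakDual ℂ S.AP} (hφ : φ ∈ S.means) (s t : K) :
    IsWeakIntegral (S.pconv s t) (fun z => dualEmbedding.{u, v} S (S.dualTranslate z φ))
      (dualEmbedding.{u, v} S (S.dualTranslate s (S.dualTranslate t φ))) := by
  refine .pi fun f => ?_
  have hint : Integrable (fun z => dualEmbedding S (S.dualTranslate z φ) f) (S.pconv s t) :=
    integrable_of_continuous_of_forall_mem _
      ((continuous_apply f).comp (continuous_dualEmbedding_dualTranslate hφ))
      (S.isCompact_image_means.image (continuous_apply f))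
      fun z => ⟨_, ⟨_, dualTranslate_mem_means hφ z, rfl⟩, rfl⟩
  have heq : dualEmbedding S (S.dualTranslate s (S.dualTranslate t φ)) f =
      ∫ z, dualEmbedding S (S.dualTranslate z φ) f ∂(S.pconv s t) := by
    have happly := S.apply_apTranslate_apTranslate (WeakDual.toStrongDual φ) s t
    refine Prod.ext ?_ (BoundedContinuousFunction.ext fun x => ?_)
    · exact (happly f.down).trans
        ((ContinuousLinearMap.fst ℂ ℂ (K →ᵇ ℂ)).integral_comp_comm hint)
    · exact (happly (S.apTranslate x f.down)).trans
        (((evalCLM ℂ x).comp (.snd ℂ ℂ (K →ᵇ ℂ))).integral_comp_comm hint)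
  exact heq ▸ isWeakIntegral_integral hint

/-- The action `(s, φ) ↦ φ ∘ L_s` of `K` on the means of `AP(K)`. -/
def meanAction : S.SepContAction (dualEmbedding.{u, v} S '' S.means) where
  act s c := ⟨fun f => S.coordTranslate s (c.1 f), by
    obtain ⟨_, φ, hφ, rfl⟩ := c
    exact ⟨_, dualTranslate_mem_means hφ s,
      funext fun f => (S.coordTranslate_dualEmbedding s φ f).symm⟩⟩
  act_act s t := by
    rintro ⟨_, φ, hφ, rfl⟩ l
    simp only [coordTranslate_dualEmbedding]
    exact (isWeakIntegral_dualEmbedding hφ s t l).2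
  act_identity e he := by
    rintro ⟨_, φ, hφ, rfl⟩
    have hfix : S.dualTranslate e φ = φ := ContinuousLinearMap.ext fun f =>
      congrArg φ (Subtype.ext (S.leftTranslate_identity he f) : S.apTranslate e f = f)
    simp only [coordTranslate_dualEmbedding, hfix]
  continuous_act s := continuous_induced_rng.2 <| continuous_pi fun f =>
    (S.coordTranslate s).continuous.comp ((continuous_apply f).comp continuous_subtype_val)
  continuous_orbit := by
    rintro ⟨_, φ, hφ, rfl⟩
    simp only [coordTranslate_dualEmbedding]
    exact continuous_induced_rng.2 (continuous_dualEmbedding_dualTranslate hφ)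

/-- The norms of the coordinates, as seminorms on the product space. -/
def coordSeminorms : Set (Seminorm ℝ (ULift.{v} S.AP → ℂ × (K →ᵇ ℂ))) :=
  Set.range fun f => (normSeminorm ℝ (ℂ × (K →ᵇ ℂ))).comp (LinearMap.proj f)

theorem withSeminorms_coordSeminorms : WithSeminorms (fun p : coordSeminorms.{u, v} S =>
    (p : Seminorm ℝ (ULift.{v} S.AP → ℂ × (K →ᵇ ℂ)))) := by
  rw [SeminormFamily.withSeminorms_iff_nhds_eq_iInf, nhds_pi, Filter.pi]
  refine Eq.trans ?_ (iInf_range' (fun p : Seminorm ℝ (ULift.{v} S.AP → ℂ × (K →ᵇ ℂ)) =>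
    (𝓝 (0 : ℝ)).comap p) _).symm
  refine iInf_congr fun f => ?_
  rw [Pi.zero_apply, ← comap_norm_nhds_zero, Filter.comap_comap]
  rfl

theorem isNonexpansive_meanAction :
    (meanAction.{u, v} S).IsNonexpansive (coordSeminorms.{u, v} S) := by
  rintro _ ⟨f, rfl⟩ s c d
  change ‖S.coordTranslate s (c.1 f) - S.coordTranslate s (d.1 f)‖ ≤ ‖c.1 f - d.1 f‖
  rw [← map_sub]
  exact S.norm_coordTranslate_le s _

variable {S} in
theorem norm_eq_one_of_mem_means [Nonempty K] {φ : WeakDual ℂ S.AP} (hφ : φ ∈ S.means) :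
    ‖WeakDual.toStrongDual φ‖ = 1 := by
  refine le_antisymm ?_ ?_
  · exact (WeakDual.toStrongDual φ).opNorm_le_bound zero_le_one fun f =>
      (hφ.1 f).trans_eq (one_mul _).symm
  · have hone : ‖(⟨1, S.one_mem_AP⟩ : S.AP)‖ = 1 := norm_one (α := K →ᵇ ℂ)
    calc 1 = ‖φ ⟨1, S.one_mem_AP⟩‖ := by rw [hφ.2, norm_one]
      _ ≤ ‖WeakDual.toStrongDual φ‖ * ‖(⟨1, S.one_mem_AP⟩ : S.AP)‖ :=
        (WeakDual.toStrongDual φ).le_opNorm _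
      _ = ‖WeakDual.toStrongDual φ‖ := by rw [hone, mul_one]

theorem isLeftAmenableAP_of_isCommonFixedPoint [Nonempty K] {c : dualEmbedding.{u, v} S '' S.means}
    (hc : (meanAction.{u, v} S).IsCommonFixedPoint c) : S.IsLeftAmenableAP := by
  obtain ⟨_, φ, hφ, rfl⟩ := c
  have hfix (s : K) (f : S.AP) : φ (S.apTranslate s f) = φ f :=
    congrArg Prod.fst (congrFun (congrArg Subtype.val (hc s)) ⟨f⟩)
  refine ⟨WeakDual.toStrongDual φ, norm_eq_one_of_mem_means hφ, hφ.2, fun x f g hg => ?_⟩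
  rw [← (Subtype.ext hg.symm : S.apTranslate x f = g)]
  exact hfix x f

end MeanAction

end SemitopologicalSemihypergroup

end Semihyper

end

theorem theorem3p4 {K : Type u} [TopologicalSpace K] [T2Space K] [LocallyCompactSpace K]
    [MeasurableSpace K] [BorelSpace K] [Nonempty K]
    (S : Semihyper.SemitopologicalSemihypergroup K) :
    S.IsLeftAmenableAP ↔
      ∀ (E : Type (max u v)) [AddCommGroup E] [Module ℝ E] [TopologicalSpace E]
        [IsTopologicalAddGroup E] [ContinuousSMul ℝ E] [T2Space E]
        (Q : Set (Seminorm ℝ E)), WithSeminorms (fun p : Q => (p : Seminorm ℝ E)) →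
        ∀ C : Set E, IsCompact C → Convex ℝ C → C.Nonempty →
        ∀ π : S.SepContAction C, π.IsNonexpansive Q → ∃ x : C, π.IsCommonFixedPoint x := by
  refine ⟨fun hS E _ _ _ _ _ _ Q hQ C hC hconv hne π hπ =>
    π.exists_isCommonFixedPoint hS hQ hC hconv hne hπ, fun h => ?_⟩
  obtain ⟨c, hc⟩ := h _ S.coordSeminorms S.withSeminorms_coordSeminorms _ S.isCompact_image_means
    S.convex_image_means (S.means_nonempty.image _) S.meanAction S.isNonexpansive_meanAction
  exact S.isLeftAmenableAP_of_isCommonFixedPoint hc
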